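/- Let $k\ge 1$ be an integer and $\mu\in\mathbb C$. Consider germs at the origin of complex analytic families of vector fields $X(x;\lambda)\,\frac{\partial}{\partial x}$ on $(\mathbb C,0)$, with parameter $\lambda\in(\mathbb C^m,0)$ for arbitrary $m$. A deformation of $X_0(x)\frac{\partial}{\partial x}$ is such a family with $X(x;0)=X_0(x)$. Two deformations $X,X'$ of $X_0$ with the same parameter are equivalent if there is an analytic germ $\phi(x;\lambda)$ at $(0,0)$ with $\phi(x;0)\equiv x$ and $X'(\phi(x;\lambda);\lambda)=X(x;\lambda)\,\frac{\partial\phi}{\partial x}(x;\lambda)$. A deformation $X'(x;\lambda')$ of $X_0$ with parameter $\lambda'\in(\mathbb C^n,0)$ is universal if for every $m$ and every deformation $X(x;\lambda)$ of $X_0$, $\lambda\in(\mathbb C^m,0)$, there is a germ of analytic map $\psi:(\mathbb C^m,0)\to(\mathbb C^n,0)$ such that $X(x;\lambda)$ is equivalent to the induced deformation $X'(x;\psi(\lambda))$, and this germ $\psi$ is unique. Then both of the families $$X_1(x;y)=\left(x^{k+1}+y_{k-1}x^{k-1}+\dots+y_1x+y_0-(\mu+y_{2k+1})x^{2k+1}\right)\frac{\partial}{\partial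 x},$$ $$X_2(x;y)=\left(x^{k+1}+y_{k-1}x^{k-1}+\dots+y_1x+y_0\right)\left(1-(\mu+y_{2k+1})x^k\right)\frac{\partial}{\partial x},$$ with parameter $y=(y_0,\dots,y_{k-1},y_{2k+1})\in(\mathbb C^{k+1},0)$, are universal deformations of $\left(x^{k+1}-\mu x^{2k+1}\right)\frac{\partial}{\partial x}$. -/

import Mathlib

open Filter Topology

/-! Germs at the origin of analytic parametric families of vector fields `X(x; l) ∂/∂x` on `(ℂ, 0)`.
A family is given by its coefficient function `X : ℂ → Λ → ℂ`, where `Λ` is the space of the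
parameter `l`; germs are represented by functions, and identities between germs are identities
that hold in a neighbourhood of the origin. -/

namespace VectorFieldFamily

section General

variable {Λ Λ' : Type*} [NormedAddCommGroup Λ] [NormedSpace ℂ Λ]
  [NormedAddCommGroup Λ'] [NormedSpace ℂ Λ']

/-- `X` is (jointly) analytic at `(x, l) = (0, 0)`. -/
def IsAnalyticFamily (X : ℂ → Λ → ℂ) : Prop :=
  AnalyticAt ℂ (fun p : ℂ × Λ => X p.1 p.2) (0, 0)

/-- `X` is an analytic deformation of the vector field `X₀(x) ∂/∂x`: an analytic family with
`X(x; 0) = X₀(x)` as germs at `x = 0`. -/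
def IsDeformation (X : ℂ → Λ → ℂ) (X₀ : ℂ → ℂ) : Prop :=
  IsAnalyticFamily X ∧ ∀ᶠ x in 𝓝 (0 : ℂ), X x 0 = X₀ x

/-- `x' = φ(x; l)` is an analytic invertible change of coordinate `(ℂ, 0) → (ℂ, 0)` depending
analytically on `l`, fixing the parameter, and `X = φ^* X'`, that is
`X'(φ(x; l); l) = X(x; l) ∂φ/∂x (x; l)` near `(0, 0)`.  -/
def IsConjugacy (φ : ℂ → Λ → ℂ) (X X' : ℂ → Λ → ℂ) : Prop :=
  AnalyticAt ℂ (fun p : ℂ × Λ => φ p.1 p.2) (0, 0) ∧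
  φ 0 0 = 0 ∧
  deriv (fun x => φ x 0) 0 ≠ 0 ∧
  ∀ᶠ p in 𝓝 ((0, 0) : ℂ × Λ),
    X' (φ p.1 p.2) p.2 = X p.1 p.2 * deriv (fun x => φ x p.2) p.1

/-- Two families with the same parameter are equivalent as deformations: they are conjugate by a
transformation `φ` with `φ(x; 0) ≡ x`. -/
def EquivalentDeformations (X X' : ℂ → Λ → ℂ) : Prop :=
  ∃ φ : ℂ → Λ → ℂ, IsConjugacy φ X X' ∧ ∀ᶠ x in 𝓝 (0 : ℂ), φ x 0 = x

/-- The family `X(x; l) = X'(x; ψ(l))` induced from `X'` by `ψ`. -/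
def induced (ψ : Λ → Λ') (X' : ℂ → Λ' → ℂ) : ℂ → Λ → ℂ :=
  fun x l => X' x (ψ l)

/-- `ψ` represents a germ of analytic map `(Λ, 0) → (Λ', 0)` (not necessarily invertible) such that
`X` is equivalent, as a deformation, to the family induced from `X'` by `ψ`. -/
def IsInducingMap (ψ : Λ → Λ') (X : ℂ → Λ → ℂ) (X' : ℂ → Λ' → ℂ) : Prop :=
  AnalyticAt ℂ ψ 0 ∧ ψ 0 = 0 ∧ EquivalentDeformations X (induced ψ X')

/-- `X'` is a versal deformation of `X₀`: every analytic deformation of `X₀`, with any finite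
number `m` of complex parameters, is equivalent to one induced from `X'`. -/
def IsVersalDeformation (X' : ℂ → Λ' → ℂ) (X₀ : ℂ → ℂ) : Prop :=
  IsDeformation X' X₀ ∧
  ∀ (m : ℕ) (X : ℂ → (Fin m → ℂ) → ℂ), IsDeformation X X₀ →
    ∃ ψ : (Fin m → ℂ) → Λ', IsInducingMap ψ X X'

/-- `X'` is a universal deformation of `X₀`: it is versal, and the germ at `0` of the inducing map
of every deformation of `X₀` is unique. -/
def IsUniversalDeformation (X' : ℂ → Λ' → ℂ) (X₀ : ℂ → ℂ) : Prop :=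
  IsVersalDeformation X' X₀ ∧
  ∀ (m : ℕ) (X : ℂ → (Fin m → ℂ) → ℂ), IsDeformation X X₀ →
    ∀ ψ₁ ψ₂ : (Fin m → ℂ) → Λ', IsInducingMap ψ₁ X X' → IsInducingMap ψ₂ X X' →
      ψ₁ =ᶠ[𝓝 0] ψ₂

end General

/-- The normal form `x^(k+1) - μ x^(2k+1)` of a parabolic point. -/
def parabolicNormalForm (k : ℕ) (μ : ℂ) : ℂ → ℂ :=
  fun x => x ^ (k + 1) - μ * x ^ (2 * k + 1)

/-- Parameters `(y_0, …, y_{k-1}, y_{2k+1})`: the coordinate `y_j`, `j < k`, is `y.1 j`, and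
`y_{2k+1}` is `y.2`. -/
abbrev Param (k : ℕ) : Type := (Fin k → ℂ) × ℂ

/-- `x^(k+1) + y_{k-1} x^(k-1) + … + y_1 x + y_0`. -/
def unfoldingPoly (k : ℕ) (x : ℂ) (y : Param k) : ℂ :=
  x ^ (k + 1) + ∑ j : Fin k, y.1 j * x ^ (j : ℕ)

/-- `X_1 = x^(k+1) + y_{k-1} x^(k-1) + … + y_0 - (μ + y_{2k+1}) x^(2k+1)`. -/
def kostovX1 (k : ℕ) (μ : ℂ) : ℂ → Param k → ℂ :=
  fun x y => unfoldingPoly k x y - (μ + y.2) * x ^ (2 * k + 1)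

/-- `X_2 = (x^(k+1) + y_{k-1} x^(k-1) + … + y_0) (1 - (μ + y_{2k+1}) x^k)`. -/
def kostovX2 (k : ℕ) (μ : ℂ) : ℂ → Param k → ℂ :=
  fun x y => unfoldingPoly k x y * (1 - (μ + y.2) * x ^ k)

end VectorFieldFamily

/-! The conjugacy equation is solved by the implicit function theorem in a Banach algebra. After
rescaling `x ↦ r x`, a field becomes `Ξ(x) = X(r x)`, the coordinate change is written `φ(r x) = r
(x + h(x))`, and the equation reads `X'(r (x + h); y) = Ξ (1 + h')`, with unknowns `h` and `y`.

Take `r = 1` to see the linearization at `X₀ = x^(k+1) u`, `u = 1 - μ x^k`. It is `X₀' h - X₀ h'`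
plus the first-order variation of the family in `y`. With `h = u p` the first part equals `x^k u²
((k+1) p - x p')`. The Euler operator multiplies the coefficient of degree `n` by `k + 1 - n`: its
kernel is spanned by `x^(k+1)`, that is `h = X₀`, and its image misses degree `k + 1` only. So,
after division by `u²`, exactly the degrees `0, …, k-1` and `2k+1` are missed, and these are
supplied by the `k + 1` parameters. Prescribing the coefficient `s` of degree `k + 1` of `h / u`
removes the kernel, and the linearization becomes bijective (`linearizedOp_injective`,
`linearizedOp_surjective`). This gives a solution analytic in `(s, Ξ)`.

Uniqueness of `y`: the normalization `s` is the only freedom left. A change of `s` moves the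
solution along the flow of the vector field itself, a symmetry that leaves `y` fixed; hence `y`
depends on `Ξ` alone (`exists_solution`).

The algebra consists of the power series with summable coefficients. The unknown is `g = h'`
together with `c = h(0)`, because the primitive is bounded there and the derivative is not. A
functional calculus turns a deformation into an analytic map `l ↦ Ξ`, and every conjugacy gives a
small solution of the equation. -/

/-! ### The Wiener algebra of absolutely summable power series -/

/-- Power series whose coefficients are absolutely summable. -/
noncomputable def wienerSubalgebra : Subalgebra ℂ (PowerSeries ℂ) where
  carrier := {f | Summable fun n => ‖PowerSeries.coeff n f‖}
  mul_mem' := by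
    intro f g hf hg
    simpa [PowerSeries.coeff_mul] using summable_norm_sum_mul_antidiagonal_of_summable_norm hf hg
  add_mem' := by
    intro f g hf hg
    refine Summable.of_nonneg_of_le (fun n => norm_nonneg _) (fun n => ?_) (hf.add hg)
    simpa using norm_add_le _ _
  algebraMap_mem' := by
    intro c
    refine summable_of_ne_finset_zero (s := {0}) fun n hn => ?_
    simp only [Finset.mem_singleton] at hn
    simp [PowerSeries.coeff_C, hn]

/-- The Wiener algebra of power series with absolutely summable coefficients. -/
def WienerAlgebra : Type := wienerSubalgebra

namespace WienerAlgebra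

local notation "𝕎" => WienerAlgebra

noncomputable instance : CommRing 𝕎 := inferInstanceAs (CommRing wienerSubalgebra)

noncomputable instance : Algebra ℂ 𝕎 := inferInstanceAs (Algebra ℂ wienerSubalgebra)

/-- The underlying power series. -/
noncomputable def toPS : 𝕎 →ₐ[ℂ] PowerSeries ℂ := wienerSubalgebra.val

/-- The `n`-th coefficient. -/
noncomputable def coeff (n : ℕ) (f : 𝕎) : ℂ := PowerSeries.coeff n (toPS f)

lemma summable_coeff (f : 𝕎) : Summable fun n => ‖coeff n f‖ := f.2

lemma toPS_injective : Function.Injective toPS := Subtype.val_injective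

lemma ext_coeff {f g : 𝕎} (h : ∀ n, coeff n f = coeff n g) : f = g :=
  toPS_injective (PowerSeries.ext h)

@[simp] lemma coeff_add (n : ℕ) (f g : 𝕎) : coeff n (f + g) = coeff n f + coeff n g := by
  simp [coeff]

@[simp] lemma coeff_sub (n : ℕ) (f g : 𝕎) : coeff n (f - g) = coeff n f - coeff n g := by
  simp [coeff]

@[simp] lemma coeff_neg (n : ℕ) (f : 𝕎) : coeff n (-f) = -coeff n f := by
  simp [coeff]

@[simp] lemma coeff_zero (n : ℕ) : coeff n (0 : 𝕎) = 0 := by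
  simp [coeff]

@[simp] lemma coeff_smul (n : ℕ) (c : ℂ) (f : 𝕎) : coeff n (c • f) = c * coeff n f := by
  simp [coeff]

lemma coeff_mul (n : ℕ) (f g : 𝕎) :
    coeff n (f * g) = ∑ p ∈ Finset.HasAntidiagonal.antidiagonal n, coeff p.1 f * coeff p.2 g := by
  simp [coeff, PowerSeries.coeff_mul]

lemma coeff_one (n : ℕ) : coeff n (1 : 𝕎) = if n = 0 then 1 else 0 := by
  simp [coeff, PowerSeries.coeff_one]

lemma norm_coeff_le_tsum (n : ℕ) (f : 𝕎) : ‖coeff n f‖ ≤ ∑' n, ‖coeff n f‖ :=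
  (summable_coeff f).le_tsum n fun _ _ => norm_nonneg _

/-- The `ℓ¹` norm on the coefficients. -/
noncomputable def addGroupNorm : AddGroupNorm 𝕎 where
  toFun f := ∑' n, ‖coeff n f‖
  map_zero' := by simp
  add_le' f g := by
    rw [← (summable_coeff f).tsum_add (summable_coeff g)]
    refine (summable_coeff _).tsum_le_tsum (fun n => ?_)
      ((summable_coeff f).add (summable_coeff g))
    simpa using norm_add_le _ _
  neg' f := by simp
  eq_zero_of_map_eq_zero' f hf := by
    refine ext_coeff fun n => ?_
    have := norm_coeff_le_tsum n f
    rw [hf] at this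
    simpa using this

noncomputable instance : NormedCommRing 𝕎 where
  __ := addGroupNorm.toNormedAddCommGroup
  __ := (inferInstance : CommRing 𝕎)
  norm_mul_le f g := by
    change ∑' n, ‖coeff n (f * g)‖ ≤ (∑' n, ‖coeff n f‖) * ∑' n, ‖coeff n g‖
    rw [tsum_mul_tsum_eq_tsum_sum_antidiagonal_of_summable_norm (summable_coeff f).norm
        (summable_coeff g).norm]
    refine (summable_coeff _).tsum_le_tsum (fun n => ?_)
      ?_
    · rw [coeff_mul]
      refine (norm_sum_le _ _).trans (le_of_eq ?_)
      simp
    · exact (summable_norm_sum_mul_antidiagonal_of_summable_norm (summable_coeff f).norm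
        (summable_coeff g).norm).of_norm

lemma norm_def (f : 𝕎) : ‖f‖ = ∑' n, ‖coeff n f‖ := rfl

lemma norm_coeff_le (n : ℕ) (f : 𝕎) : ‖coeff n f‖ ≤ ‖f‖ := norm_coeff_le_tsum n f

noncomputable instance : NormedAlgebra ℂ 𝕎 where
  __ := (inferInstance : Algebra ℂ 𝕎)
  norm_smul_le c f := by
    rw [norm_def, norm_def, ← tsum_mul_left]
    simp

noncomputable instance : NormOneClass 𝕎 where
  norm_one := by
    rw [norm_def, tsum_eq_single 0]
    · simp [coeff_one]
    · intro n hn; simp [coeff_one, hn]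

/-- An absolutely summable sequence as an element of the Wiener algebra. -/
noncomputable def ofSeq (a : ℕ → ℂ) (ha : Summable fun n => ‖a n‖) : 𝕎 :=
  ⟨PowerSeries.mk a, show Summable _ by simpa using ha⟩

@[simp] lemma coeff_ofSeq (a : ℕ → ℂ) (ha : Summable fun n => ‖a n‖) (n : ℕ) :
    coeff n (ofSeq a ha) = a n :=
  PowerSeries.coeff_mk n a

/-- The Wiener algebra is isometric to `ℓ¹`. -/
noncomputable def equivLp : 𝕎 ≃ lp (fun _ : ℕ => ℂ) 1 where
  toFun f := ⟨fun n => coeff n f, by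
    refine memℓp_gen ?_
    simpa using summable_coeff f⟩
  invFun a := ofSeq (fun n => a n) (by simpa using (lp.memℓp a).summable (by simp))
  left_inv f := ext_coeff fun n => by simp
  right_inv a := by ext n; simp

lemma isometry_equivLp : Isometry equivLp := by
  refine Isometry.of_dist_eq fun f g => ?_
  rw [dist_eq_norm, dist_eq_norm, lp.norm_eq_tsum_rpow (by simp), norm_def]
  simp only [ENNReal.toReal_one, Real.rpow_one, div_one, coeff_sub]
  rfl

/-- The isometry with `ℓ¹` carries completeness over; the implicit function theorem relies on it. -/
instance : CompleteSpace 𝕎 := by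
  have h := (completeSpace_congr (e := equivLp) isometry_equivLp.isUniformEmbedding).2
  exact h inferInstance

/-- The `n`-th coefficient as a continuous linear functional. -/
noncomputable def coeffL (n : ℕ) : 𝕎 →L[ℂ] ℂ :=
  LinearMap.mkContinuous
    { toFun := coeff n, map_add' := coeff_add n, map_smul' := by simp } 1
    (fun f => by simpa using norm_coeff_le n f)

@[simp] lemma coeffL_apply (n : ℕ) (f : 𝕎) : coeffL n f = coeff n f := rfl

lemma norm_coeffL_le (n : ℕ) : ‖coeffL n‖ ≤ 1 := LinearMap.mkContinuous_norm_le _ zero_le_one _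

/-! ### Evaluation on the closed unit disc -/

lemma summable_norm_eval (f : 𝕎) {x : ℂ} (hx : ‖x‖ ≤ 1) :
    Summable fun n => ‖coeff n f * x ^ n‖ := by
  refine Summable.of_nonneg_of_le (fun n => norm_nonneg _) (fun n => ?_) (summable_coeff f)
  rw [norm_mul, norm_pow]
  exact mul_le_of_le_one_right (norm_nonneg _) (pow_le_one₀ (norm_nonneg _) hx)

/-- The value of the power series at `x`. -/
noncomputable def eval (x : ℂ) (f : 𝕎) : ℂ := ∑' n, coeff n f * x ^ n

lemma norm_eval_le {x : ℂ} (hx : ‖x‖ ≤ 1) (f : 𝕎) : ‖eval x f‖ ≤ ‖f‖ := by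
  refine (norm_tsum_le_tsum_norm (summable_norm_eval f hx)).trans ?_
  refine (summable_norm_eval f hx).tsum_le_tsum (fun n => ?_) (summable_coeff f)
  rw [norm_mul, norm_pow]
  exact mul_le_of_le_one_right (norm_nonneg _) (pow_le_one₀ (norm_nonneg _) hx)

lemma eval_add {x : ℂ} (hx : ‖x‖ ≤ 1) (f g : 𝕎) : eval x (f + g) = eval x f + eval x g := by
  simp only [eval, coeff_add, add_mul]
  exact (summable_norm_eval f hx).of_norm.tsum_add (summable_norm_eval g hx).of_norm

lemma eval_smul (x c : ℂ) (f : 𝕎) : eval x (c • f) = c * eval x f := by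
  simp only [eval, coeff_smul, mul_assoc, tsum_mul_left]

lemma eval_one (x : ℂ) : eval x 1 = 1 := by
  rw [eval, tsum_eq_single 0]
  · simp [coeff_one]
  · intro n hn; simp [coeff_one, hn]

lemma eval_mul {x : ℂ} (hx : ‖x‖ ≤ 1) (f g : 𝕎) : eval x (f * g) = eval x f * eval x g := by
  simp only [eval]
  rw [tsum_mul_tsum_eq_tsum_sum_antidiagonal_of_summable_norm (summable_norm_eval f hx)
    (summable_norm_eval g hx)]
  refine tsum_congr fun n => ?_
  rw [coeff_mul, Finset.sum_mul]
  refine Finset.sum_congr rfl fun p hp => ?_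
  rw [← Finset.HasAntidiagonal.mem_antidiagonal.1 hp, pow_add]
  ring

/-- Evaluation at a point of the closed unit disc is a character. -/
noncomputable def evalHom (x : ℂ) (hx : ‖x‖ ≤ 1) : 𝕎 →ₐ[ℂ] ℂ :=
  AlgHom.ofLinearMap { toFun := eval x, map_add' := eval_add hx, map_smul' := eval_smul x }
    (eval_one x) (eval_mul hx)

@[simp] lemma evalHom_apply (x : ℂ) (hx : ‖x‖ ≤ 1) (f : 𝕎) : evalHom x hx f = eval x f := rfl

/-- Evaluation as a continuous linear functional. -/
noncomputable def evalL (x : ℂ) (hx : ‖x‖ ≤ 1) : 𝕎 →L[ℂ] ℂ :=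
  (evalHom x hx).toLinearMap.mkContinuous 1 (fun f => by simpa using norm_eval_le hx f)

/-- The power series expansion of `x ↦ (f ↦ f(x))`. -/
noncomputable def evalSeries : FormalMultilinearSeries ℂ ℂ (𝕎 →L[ℂ] ℂ) :=
  fun n => ContinuousMultilinearMap.mkPiRing ℂ (Fin n) (coeffL n)

lemma one_le_radius_evalSeries : 1 ≤ evalSeries.radius := by
  refine evalSeries.le_radius_of_bound (r := 1) 1 fun n => ?_
  simpa [evalSeries] using norm_coeffL_le n

lemma evalSeries_sum_apply {x : ℂ} (hx : ‖x‖ < 1) (f : 𝕎) : evalSeries.sum x f = eval x f := by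
  have hs : HasSum (fun n => evalSeries n fun _ => x) (evalSeries.sum x) :=
    evalSeries.hasSum (by
      refine Metric.eball_subset_eball one_le_radius_evalSeries ?_
      simpa only [Metric.mem_eball, edist_zero_right, enorm_eq_nnnorm, ENNReal.coe_lt_one_iff,
        ← NNReal.coe_lt_one, coe_nnnorm] using hx)
  have := (ContinuousLinearMap.apply ℂ ℂ f).hasSum hs
  refine this.tsum_eq.symm.trans (tsum_congr fun n => ?_)
  simp [evalSeries, mul_comm]

/-- Joint analyticity of evaluation. -/
lemma analyticAt_eval (f : 𝕎) : AnalyticAt ℂ (fun p : ℂ × 𝕎 => eval p.1 p.2) (0, f) := by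
  have h1 : AnalyticAt ℂ evalSeries.sum (0 : ℂ) :=
    (evalSeries.hasFPowerSeriesOnBall (zero_lt_one.trans_le one_le_radius_evalSeries)).analyticAt
  have h2 : AnalyticAt ℂ (fun p : ℂ × 𝕎 => evalSeries.sum p.1) (0, f) :=
    AnalyticAt.fun_comp (g := evalSeries.sum) (f := Prod.fst) h1 analyticAt_fst
  have h3 : AnalyticAt ℂ (fun p : ℂ × 𝕎 => evalSeries.sum p.1 p.2) (0, f) :=
    (h2.contDiffAt (n := ⊤).clm_apply (analyticAt_snd.contDiffAt)).analyticAt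
  refine h3.congr ?_
  have : ∀ᶠ p : ℂ × 𝕎 in 𝓝 (0, f), ‖p.1‖ < 1 := by
    have : ContinuousAt (fun p : ℂ × 𝕎 => ‖p.1‖) (0, f) := by fun_prop
    exact this.eventually_lt continuousAt_const (by simp)
  filter_upwards [this] with p hp
  exact evalSeries_sum_apply hp _

/-- Elements of the Wiener algebra are determined by their germs at the origin. -/
lemma eq_of_eventually_eval_eq {f g : 𝕎} (h : ∀ᶠ x in 𝓝 (0 : ℂ), eval x f = eval x g) :
    f = g := by
  have key : ∀ f : 𝕎, HasFPowerSeriesAt (fun x => eval x f)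
      (FormalMultilinearSeries.ofScalars ℂ fun n => coeff n f) 0 := by
    intro f
    refine ⟨1, ?_, by simp, ?_⟩
    · refine (FormalMultilinearSeries.ofScalars ℂ fun n => coeff n f).le_radius_of_bound
        (r := 1) ‖f‖ fun n => ?_
      simpa [FormalMultilinearSeries.ofScalars_norm] using norm_coeff_le n f
    · intro y hy
      have hy' : ‖y‖ ≤ 1 := by
        have : ‖y‖ < 1 := by simpa only [Metric.mem_eball, edist_zero_right, enorm_eq_nnnorm,
          ENNReal.coe_lt_one_iff, ← NNReal.coe_lt_one, coe_nnnorm] using hy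
        exact this.le
      have := (summable_norm_eval f hy').of_norm.hasSum
      simpa [FormalMultilinearSeries.ofScalars_apply_eq, eval, mul_comm] using this
  have := (key f).eq_formalMultilinearSeries_of_eventually (key g) h
  refine ext_coeff fun n => ?_
  have := congrFun (FormalMultilinearSeries.ofScalars_series_injective ℂ ℂ this) n
  simpa using this

/-! ### The variable, derivatives and primitives -/

/-- The variable. -/
noncomputable def var : 𝕎 := ⟨PowerSeries.X, by
  refine summable_of_ne_finset_zero (s := {1}) fun n hn => ?_
  simp only [Finset.mem_singleton] at hn
  simp [PowerSeries.coeff_X, hn]⟩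

lemma coeff_var (n : ℕ) : coeff n var = if n = 1 then 1 else 0 := by
  change PowerSeries.coeff n (PowerSeries.X : PowerSeries ℂ) = _
  rw [PowerSeries.coeff_X]

@[simp] lemma toPS_var : toPS var = PowerSeries.X := rfl

lemma coeff_var_pow_mul (d n : ℕ) (f : 𝕎) :
    coeff n (var ^ d * f) = if d ≤ n then coeff (n - d) f else 0 := by
  simp [coeff, PowerSeries.coeff_X_pow_mul']

@[simp] lemma eval_var {x : ℂ} : eval x var = x := by
  rw [eval, tsum_eq_single 1]
  · simp [coeff_var]
  · intro n hn; simp [coeff_var, hn]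

@[simp] lemma norm_var : ‖(var : 𝕎)‖ = 1 := by
  rw [norm_def, tsum_eq_single 1]
  · simp [coeff_var]
  · intro n hn; simp [coeff_var, hn]

lemma summable_primitive (f : 𝕎) :
    Summable fun n => ‖(if n = 0 then 0 else coeff (n - 1) f / n : ℂ)‖ := by
  rw [← summable_nat_add_iff 1]
  refine Summable.of_nonneg_of_le (fun n => norm_nonneg _) (fun n => ?_) (summable_coeff f)
  simp only [Nat.add_eq_zero_iff, one_ne_zero, and_false, if_false, Nat.add_sub_cancel, norm_div]
  refine div_le_self (norm_nonneg _) ?_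
  rw [Complex.norm_natCast]
  simp

/-- The primitive vanishing at the origin. -/
noncomputable def primitive : 𝕎 →L[ℂ] 𝕎 :=
  LinearMap.mkContinuous
    { toFun := fun f => ofSeq _ (summable_primitive f)
      map_add' := fun f g => ext_coeff fun n => by
        by_cases hn : n = 0 <;> simp [hn, add_div]
      map_smul' := fun c f => ext_coeff fun n => by
        by_cases hn : n = 0 <;> simp [hn, mul_div_assoc] } 1
    (fun f => by
      rw [one_mul, norm_def, norm_def, (summable_coeff _).tsum_eq_zero_add]
      simp only [LinearMap.coe_mk, AddHom.coe_mk, coeff_ofSeq, if_true, norm_zero, zero_add,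
        Nat.add_eq_zero_iff, one_ne_zero, and_false, if_false, Nat.add_sub_cancel, norm_div]
      have hle : ∀ n : ℕ, ‖coeff n f‖ / ‖((n + 1 : ℕ) : ℂ)‖ ≤ ‖coeff n f‖ := fun n => by
        refine div_le_self (norm_nonneg _) ?_
        rw [Complex.norm_natCast]
        simp
      exact (Summable.of_nonneg_of_le (fun n => by positivity) hle (summable_coeff f)).tsum_le_tsum
        hle (summable_coeff f))

lemma coeff_primitive (n : ℕ) (f : 𝕎) :
    coeff n (primitive f) = if n = 0 then 0 else coeff (n - 1) f / n := by
  simp [primitive]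

@[simp] lemma derivative_coe_primitive (f : 𝕎) :
    PowerSeries.derivative ℂ (toPS (primitive f)) = toPS f := by
  ext n
  rw [PowerSeries.coeff_derivative]
  change coeff (n + 1) (primitive f) * _ = coeff n f
  rw [coeff_primitive]
  have : ((n : ℂ) + 1) ≠ 0 := Nat.cast_add_one_ne_zero n
  simp [this]

/-- An element whose formal derivative is in the Wiener algebra is recovered from it. -/
lemma eq_const_add_primitive {f g : 𝕎} (h : PowerSeries.derivative ℂ (toPS f) = toPS g) :
    f = algebraMap ℂ 𝕎 (coeff 0 f) + primitive g := by
  refine ext_coeff fun n => ?_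
  rw [coeff_add, Algebra.algebraMap_eq_smul_one, coeff_smul, coeff_one, coeff_primitive]
  rcases n with _ | n
  · simp
  · have h1 := congrArg (PowerSeries.coeff n) h
    rw [PowerSeries.coeff_derivative] at h1
    have : ((n : ℂ) + 1) ≠ 0 := Nat.cast_add_one_ne_zero n
    have h2 : coeff (n + 1) f * (n + 1) = coeff n g := h1
    simp [← h2, this]

/-- On the unit disc the termwise derivatives are dominated by the summable coefficients of `f`, so
the series may be differentiated term by term. -/
lemma hasDerivAt_eval_primitive (f : 𝕎) {x : ℂ} (hx : ‖x‖ < 1) :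
    HasDerivAt (fun z => eval z (primitive f)) (eval x f) x := by
  have key := hasDerivAt_tsum_of_isPreconnected (𝕜 := ℂ) (F := ℂ)
    (u := fun n => ‖(if n = 0 then 0 else coeff (n - 1) f : ℂ)‖)
    (g := fun n z => coeff n (primitive f) * z ^ n)
    (g' := fun n z => (if n = 0 then 0 else coeff (n - 1) f * z ^ (n - 1))) (t := Metric.ball 0 1)
    (y₀ := 0) (y := x)
    (by
      rw [← summable_nat_add_iff 1]
      simpa using summable_coeff f)
    Metric.isOpen_ball (convex_ball _ _).isPreconnected
    (by
      intro n y _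
      rcases n with _ | n
      · simpa [coeff_primitive] using hasDerivAt_const y (0 : ℂ)
      · have := (hasDerivAt_pow (n + 1) y).const_mul (coeff (n + 1) (primitive f))
        refine this.congr_deriv ?_
        have : ((n : ℂ) + 1) ≠ 0 := Nat.cast_add_one_ne_zero n
        simp only [coeff_primitive, Nat.add_eq_zero_iff, one_ne_zero, and_false, if_false,
          Nat.add_sub_cancel, Nat.cast_add, Nat.cast_one]
        field_simp)
    (by
      intro n y hy
      have hy' : ‖y‖ ≤ 1 := by
        have : ‖y‖ < 1 := by simpa using hy
        exact this.le
      rcases n with _ | n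
      · simp
      · simp only [Nat.add_eq_zero_iff, one_ne_zero, and_false, if_false, Nat.add_sub_cancel,
          norm_mul, norm_pow]
        exact mul_le_of_le_one_right (norm_nonneg _) (pow_le_one₀ (norm_nonneg _) hy'))
    (by simp) ((summable_norm_eval _ (by simp)).of_norm) (by simpa using hx)
  have h2 : ∑' n, (if n = 0 then 0 else coeff (n - 1) f * x ^ (n - 1)) = eval x f := by
    rw [eval, Summable.tsum_eq_zero_add]
    · simp only [if_true, Nat.add_eq_zero_iff, one_ne_zero, and_false, if_false,
        Nat.add_sub_cancel, zero_add]
    · rw [← summable_nat_add_iff 1]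
      simpa using (summable_norm_eval f hx.le).of_norm
  rw [h2] at key
  exact key

@[simp] lemma eval_zero_primitive (f : 𝕎) : eval 0 (primitive f) = 0 := by
  rw [eval, tsum_eq_single 0]
  · simp [coeff_primitive]
  · intro n hn; simp [hn]

end WienerAlgebra

namespace WienerAlgebra

local notation "𝕎" => WienerAlgebra

/-! ### Holomorphic functional calculus -/

section FunctionalCalculus

variable {ι : Type*} [Fintype ι] [DecidableEq ι]

/-- The extension of a multilinear form on `ℂ^ι` to a multilinear map on `W^ι`. -/
noncomputable def extendMultilinear {n : ℕ}
    (p : ContinuousMultilinearMap ℂ (fun _ : Fin n => ι → ℂ) ℂ) :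
    ContinuousMultilinearMap ℂ (fun _ : Fin n => ι → 𝕎) 𝕎 :=
  ∑ s : Fin n → ι, p (fun j => Pi.single (s j) 1) •
    (ContinuousMultilinearMap.mkPiAlgebraFin ℂ n 𝕎).compContinuousLinearMap
      (fun j => ContinuousLinearMap.proj (s j))

lemma extendMultilinear_apply {n : ℕ}
    (p : ContinuousMultilinearMap ℂ (fun _ : Fin n => ι → ℂ) ℂ) (w : ι → 𝕎) :
    extendMultilinear p (fun _ => w) =
      ∑ s : Fin n → ι, p (fun j => Pi.single (s j) 1) • ∏ j, w (s j) := by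
  simp [extendMultilinear, List.prod_ofFn]

/-- There are `card ι ^ n` words `s`, and each contributes at most `‖p‖`: basis vectors have norm
one and the norm of the algebra is submultiplicative. -/
lemma norm_extendMultilinear_le {n : ℕ}
    (p : ContinuousMultilinearMap ℂ (fun _ : Fin n => ι → ℂ) ℂ) :
    ‖extendMultilinear p‖ ≤ ‖p‖ * (Fintype.card ι : ℝ) ^ n := by
  refine (norm_sum_le _ _).trans ?_
  have : ∀ s ∈ (Finset.univ : Finset (Fin n → ι)), ‖p (fun j => Pi.single (s j) 1) •
      (ContinuousMultilinearMap.mkPiAlgebraFin ℂ n 𝕎).compContinuousLinearMap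
      (fun j => ContinuousLinearMap.proj (R := ℂ) (φ := fun _ : ι => 𝕎) (s j))‖ ≤ ‖p‖ := by
    intro s _
    rw [norm_smul]
    have h1 : ‖p (fun j => Pi.single (s j) 1)‖ ≤ ‖p‖ := by
      refine (p.le_opNorm _).trans (mul_le_of_le_one_right (norm_nonneg _) ?_)
      refine Finset.prod_le_one (fun _ _ => norm_nonneg _) fun j _ => ?_
      simp [Pi.norm_single]
    have h2 : ‖(ContinuousMultilinearMap.mkPiAlgebraFin ℂ n 𝕎).compContinuousLinearMap
        (fun j => ContinuousLinearMap.proj (R := ℂ) (φ := fun _ : ι => 𝕎) (s j))‖ ≤ 1 := by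
      refine ContinuousMultilinearMap.opNorm_le_bound zero_le_one fun m => ?_
      rw [one_mul, ContinuousMultilinearMap.compContinuousLinearMap_apply,
        ContinuousMultilinearMap.mkPiAlgebraFin_apply, List.prod_ofFn]
      refine (Finset.norm_prod_le _ _).trans ?_
      exact Finset.prod_le_prod (fun _ _ => norm_nonneg _) fun j _ => norm_le_pi_norm (m j) (s j)
    exact (mul_le_mul h1 h2 (norm_nonneg _) (norm_nonneg _)).trans (mul_one _).le
  refine (Finset.sum_le_sum this).trans ?_
  simp [mul_comm]

/-- Evaluation is a character, so it passes through the products; what remains is the expansion of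
`p` in the standard basis. -/
lemma eval_extendMultilinear {n : ℕ}
    (p : ContinuousMultilinearMap ℂ (fun _ : Fin n => ι → ℂ) ℂ) (w : ι → 𝕎) {x : ℂ}
    (hx : ‖x‖ ≤ 1) :
    eval x (extendMultilinear p (fun _ => w)) = p (fun _ i => eval x (w i)) := by
  rw [extendMultilinear_apply, ← evalHom_apply x hx, map_sum]
  have : (fun i => eval x (w i)) = ∑ i, eval x (w i) • (Pi.single i 1 : ι → ℂ) := by
    ext i
    simp [Finset.sum_apply, Pi.single_apply]
  rw [this]
  have h2 := p.map_sum (fun (_ : Fin n) i => eval x (w i) • (Pi.single i 1 : ι → ℂ))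
  rw [h2]
  refine Finset.sum_congr rfl fun s _ => ?_
  rw [p.map_smul_univ]
  simp [mul_comm, map_prod]

/-- The extension of a power series on `ℂ^ι` to a power series on `W^ι`. -/
noncomputable def extendSeries (p : FormalMultilinearSeries ℂ (ι → ℂ) ℂ) :
    FormalMultilinearSeries ℂ (ι → 𝕎) 𝕎 := fun n => extendMultilinear (p n)

/-- The radius shrinks at worst by a factor of the number of variables; the `+ 1` in `N` covers an
empty `ι`. -/
lemma extendSeries_radius_pos {p : FormalMultilinearSeries ℂ (ι → ℂ) ℂ} (hp : 0 < p.radius) :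
    0 < (extendSeries p).radius := by
  obtain ⟨r, hr0, hr⟩ := ENNReal.lt_iff_exists_nnreal_btwn.1 hp
  obtain ⟨C, -, hC⟩ := p.norm_mul_pow_le_of_lt_radius hr
  have hr0' : 0 < r := by exact_mod_cast hr0
  set N : NNReal := (Fintype.card ι : NNReal) + 1
  have hN : 0 < N := by positivity
  have : ((r / N : NNReal) : ENNReal) ≤ (extendSeries p).radius := by
    refine (extendSeries p).le_radius_of_bound C fun n => ?_
    refine le_trans ?_ (hC n)
    have h1 := norm_extendMultilinear_le (p n)
    have h2 : ((Fintype.card ι : ℝ)) ^ n ≤ (N : ℝ) ^ n := by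
      refine pow_le_pow_left₀ (by positivity) ?_ n
      simp [N]
    have hN' : (0 : ℝ) < N := hN
    calc ‖extendSeries p n‖ * ((r / N : NNReal) : ℝ) ^ n
        ≤ (‖p n‖ * (N : ℝ) ^ n) * ((r / N : NNReal) : ℝ) ^ n := by
          refine mul_le_mul_of_nonneg_right (h1.trans ?_) (by positivity)
          exact mul_le_mul_of_nonneg_left h2 (norm_nonneg _)
      _ = ‖p n‖ * (r : ℝ) ^ n := by
          rw [NNReal.coe_div, div_pow]
          field_simp
  exact lt_of_lt_of_le (by exact_mod_cast div_pos hr0' hN) this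

/-- Holomorphic functional calculus for germs at the origin of functions of several variables. -/
lemma exists_functionalCalculus {f : (ι → ℂ) → ℂ} (hf : AnalyticAt ℂ f 0) :
    ∃ F : (ι → 𝕎) → 𝕎, AnalyticAt ℂ F 0 ∧
      ∀ᶠ w in 𝓝 (0 : ι → 𝕎), ∀ x : ℂ, ‖x‖ ≤ 1 → eval x (F w) = f fun i => eval x (w i) := by
  obtain ⟨p, ρ, hp⟩ := hf
  have hpos : 0 < (extendSeries p).radius := extendSeries_radius_pos (hp.r_pos.trans_le hp.r_le)
  have hF := (extendSeries p).hasFPowerSeriesOnBall hpos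
  refine ⟨(extendSeries p).sum, hF.analyticAt, ?_⟩
  have hmem : Metric.eball (0 : ι → 𝕎) (min (extendSeries p).radius ρ) ∈ 𝓝 (0 : ι → 𝕎) :=
    Metric.eball_mem_nhds _ (lt_min hpos hp.r_pos)
  filter_upwards [hmem] with w hw x hx
  rw [Metric.mem_eball, lt_min_iff] at hw
  have h1 := (evalL x hx).hasSum ((extendSeries p).hasSum (Metric.mem_eball.2 hw.1))
  -- Evaluation does not increase norms, so the tuple of values stays in the ball where `f` is given
  -- by its series.
  have hle : edist (fun i => eval x (w i)) 0 ≤ edist w 0 := by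
    rw [edist_pi_def, edist_pi_def]
    refine Finset.sup_mono_fun fun i _ => ?_
    simp only [Pi.zero_apply, edist_zero_right, enorm_eq_nnnorm]
    exact_mod_cast norm_eval_le hx (w i)
  have h2 := hp.hasSum (y := fun i => eval x (w i)) (Metric.mem_eball.2 (hle.trans_lt hw.2))
  rw [zero_add] at h2
  refine h1.unique (h2.congr_fun ?_)
  intro n
  exact eval_extendMultilinear (p n) w hx

end FunctionalCalculus

/-- A germ of analytic function `f(x; l)` as an analytic family of elements of the Wiener algebra,
once the variable `x` is rescaled. -/
lemma exists_analytic_family {m : ℕ} {f : ℂ × (Fin m → ℂ) → ℂ} (hf : AnalyticAt ℂ f (0, 0)) :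
    ∀ᶠ r : ℂ in 𝓝 0, ∃ S : (Fin m → ℂ) → 𝕎, AnalyticAt ℂ S 0 ∧
      ∀ᶠ l in 𝓝 (0 : Fin m → ℂ), ∀ x : ℂ, ‖x‖ ≤ 1 → eval x (S l) = f (r * x, l) := by
  have hf' : AnalyticAt ℂ (fun w : Option (Fin m) → ℂ => f (w none, fun i => w (some i))) 0 := by
    refine AnalyticAt.fun_comp (g := f)
      (f := fun w : Option (Fin m) → ℂ => (w none, fun i => w (some i))) hf ?_
    refine AnalyticAt.prod ?_ ?_
    · exact (ContinuousLinearMap.proj (R := ℂ) (φ := fun _ : Option (Fin m) => ℂ) none).analyticAt _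
    · exact AnalyticAt.pi fun i => (ContinuousLinearMap.proj (R := ℂ)
        (φ := fun _ : Option (Fin m) => ℂ) (some i)).analyticAt _
  obtain ⟨F, hF, hFe⟩ := exists_functionalCalculus hf'
  -- The variable enters as `r • var` and each parameter as a constant series.
  let T : ℂ × (Fin m → ℂ) → Option (Fin m) → 𝕎 :=
    fun q o => o.elim (q.1 • var) (fun i => q.2 i • (1 : 𝕎))
  have hT : Continuous T := by
    refine continuous_pi fun o => ?_
    cases o
    · exact continuous_fst.smul continuous_const
    · exact ((continuous_apply _).comp continuous_snd).smul continuous_const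
  have hT0 : T (0, 0) = 0 := by
    ext o; cases o <;> simp [T]
  have hTt : Tendsto T (𝓝 (0, 0)) (𝓝 0) := by
    have := hT.tendsto (0, 0)
    rwa [hT0] at this
  -- Analyticity of `F` and the evaluation identity hold on a neighbourhood of `0`, hence around `T
  -- (r, 0)` for every small `r`.
  have hev := hTt.eventually (hF.eventually_analyticAt.and hFe.eventually_nhds)
  rw [nhds_prod_eq] at hev
  filter_upwards [hev.curry] with r hr
  obtain ⟨hr1, hr2⟩ := hr.self_of_nhds
  refine ⟨fun l => F (T (r, l)), ?_, ?_⟩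
  · refine AnalyticAt.fun_comp (g := F) (f := fun l => T (r, l)) hr1 ?_
    refine AnalyticAt.pi fun o => ?_
    cases o
    · exact (analyticAt_const : AnalyticAt ℂ (fun _ : Fin m → ℂ => r • (var : 𝕎)) 0)
    · rename_i i
      have h1 : AnalyticAt ℂ (fun l : Fin m → ℂ => l i) 0 :=
        (ContinuousLinearMap.proj (R := ℂ) (φ := fun _ : Fin m => ℂ) i).analyticAt _
      exact h1.fun_smul (analyticAt_const (v := (1 : 𝕎)))
  · have hc : Tendsto (fun l => T (r, l)) (𝓝 0) (𝓝 (T (r, 0))) :=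
      (hT.comp (Continuous.prodMk_right r)).tendsto 0
    filter_upwards [hc.eventually hr2] with l hl x hx
    rw [hl x hx]
    simp [T, eval_smul, eval_one]

end WienerAlgebra

/-! ### Polynomial data: the normal form and its first-order deformations -/

namespace VectorFieldFamily

open Polynomial in
/-- The polynomial `x^(k+1) - μ x^(2k+1)`. -/
noncomputable def parabolicPoly (k : ℕ) (μ : ℂ) : ℂ[X] := X ^ (k + 1) - C μ * X ^ (2 * k + 1)

open Polynomial in
/-- The infinitesimal deformation `(∑ η_j x^j) (1 - d x^k) - η_{2k+1} x^(2k+1)`. -/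
noncomputable def tangentPoly (k : ℕ) (d : ℂ) (η : Param k) : ℂ[X] :=
  (∑ j : Fin k, C (η.1 j) * X ^ (j : ℕ)) * (1 - C d * X ^ k) - C η.2 * X ^ (2 * k + 1)

end VectorFieldFamily

namespace WienerAlgebra

open VectorFieldFamily

local notation "𝕎" => WienerAlgebra

/-! ### The linearized conjugacy equation -/

/-- `g` is the derivative of `f`. -/
def IsDeriv (f g : 𝕎) : Prop := PowerSeries.derivative ℂ (toPS f) = toPS g

lemma IsDeriv.coeff {f g : 𝕎} (h : IsDeriv f g) (n : ℕ) :
    coeff n g = coeff (n + 1) f * (n + 1) := by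
  have := congrArg (PowerSeries.coeff n) h
  rw [PowerSeries.coeff_derivative] at this
  exact this.symm

lemma isDeriv_of_coeff {f g : 𝕎} (h : ∀ n, WienerAlgebra.coeff n g =
    WienerAlgebra.coeff (n + 1) f * (n + 1)) : IsDeriv f g := by
  refine PowerSeries.ext fun n => ?_
  rw [PowerSeries.coeff_derivative]
  exact (h n).symm

lemma IsDeriv.mul {f f' g g' : 𝕎} (hf : IsDeriv f f') (hg : IsDeriv g g') :
    IsDeriv (f * g) (f' * g + f * g') := by
  unfold IsDeriv at *
  rw [map_mul, Derivation.leibniz, hf, hg]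
  simp only [smul_eq_mul, map_add, map_mul]
  ring

lemma IsDeriv.aeval {f f' : 𝕎} (hf : IsDeriv f f') (p : Polynomial ℂ) :
    IsDeriv (Polynomial.aeval f p) (Polynomial.aeval f (Polynomial.derivative p) * f') := by
  unfold IsDeriv at *
  rw [map_mul, ← hf, ← Polynomial.aeval_algHom_apply toPS f p,
    ← Polynomial.aeval_algHom_apply toPS f, Derivation.map_aeval, smul_eq_mul]

lemma isDeriv_const_add_primitive (c : ℂ) (g : 𝕎) :
    IsDeriv (algebraMap ℂ 𝕎 c + primitive g) g := by
  unfold IsDeriv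
  rw [map_add, map_add, AlgHom.commutes, Derivation.map_algebraMap, derivative_coe_primitive,
    zero_add]

lemma coeff_zero_algebraMap (c : ℂ) : coeff 0 (algebraMap ℂ 𝕎 c) = c := by
  simp [Algebra.algebraMap_eq_smul_one, coeff_one]

lemma coeff_zero_const_add_primitive (c : ℂ) (g : 𝕎) :
    coeff 0 (algebraMap ℂ 𝕎 c + primitive g) = c := by
  simp [coeff_primitive, coeff_zero_algebraMap]

lemma coeff_var_mul_of_isDeriv {p p' : 𝕎} (h : IsDeriv p p') (n : ℕ) :
    coeff n (var * p') = n * coeff n p := by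
  have := coeff_var_pow_mul 1 n p'
  rw [pow_one] at this
  rw [this]
  rcases n with _ | n
  · simp
  · simp [h.coeff, mul_comm]

lemma coeff_algebraMap_mul (c : ℂ) (n : ℕ) (f : 𝕎) :
    coeff n (algebraMap ℂ 𝕎 c * f) = c * coeff n f := by
  rw [← Algebra.smul_def, coeff_smul]

lemma eq_zero_of_var_pow_mul_eq_zero {d : ℕ} {f : 𝕎} (h : var ^ d * f = 0) : f = 0 := by
  refine ext_coeff fun n => ?_
  have := coeff_var_pow_mul d (n + d) f
  rw [h] at this
  simpa using this.symm

/-- Division by a power of the variable. -/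
lemma exists_eq_var_pow_mul {d : ℕ} {f : 𝕎} (h : ∀ j < d, coeff j f = 0) :
    ∃ e, f = var ^ d * e := by
  refine ⟨ofSeq (fun n => coeff (n + d) f) ((summable_nat_add_iff d).2 (summable_coeff f)), ?_⟩
  refine ext_coeff fun n => ?_
  rw [coeff_var_pow_mul]
  split_ifs with hn
  · simp [hn]
  · exact h n (not_le.1 hn)

/-- The polynomial with given first coefficients. -/
lemma coeff_sum_var_pow {k : ℕ} (a : Fin k → ℂ) (j : Fin k) :
    coeff j (∑ i : Fin k, algebraMap ℂ 𝕎 (a i) * var ^ (i : ℕ)) = a j := by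
  have : coeffL j (∑ i : Fin k, algebraMap ℂ 𝕎 (a i) * var ^ (i : ℕ)) = a j := by
    rw [map_sum, Finset.sum_eq_single j]
    · have := coeff_var_pow_mul j j 1
      rw [mul_one] at this
      rw [coeffL_apply, coeff_algebraMap_mul, this]
      simp [coeff_one]
    · intro i _ hij
      have := coeff_var_pow_mul i j 1
      rw [mul_one] at this
      rw [coeffL_apply, coeff_algebraMap_mul, this, coeff_one]
      split_ifs with h1 h2
      · exact absurd (Fin.ext (by omega)) hij
      all_goals simp
    · simp
  exact this

/-- Solution of the Euler equation `(k+1) p - x p' = e`. -/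
lemma exists_euler_solution (k : ℕ) (e : 𝕎) (he : coeff (k + 1) e = 0) (s : ℂ) :
    ∃ p p' : 𝕎, IsDeriv p p' ∧ ((k : 𝕎) + 1) * p - var * p' = e ∧ coeff (k + 1) p = s := by
  -- Degree `k + 1` is the resonance of the Euler operator: there `e` has to vanish and the
  -- coefficient of `p` is free.
  set a : ℕ → ℂ := fun n => if n = k + 1 then s else coeff n e / ((k : ℂ) + 1 - n) with ha
  have hdist : ∀ n : ℕ, n ≠ k + 1 → 1 ≤ ‖(k : ℂ) + 1 - n‖ := by
    intro n hn
    have h1 : ((k : ℂ) + 1 - n) = (((k : ℤ) + 1 - n : ℤ) : ℂ) := by push_cast; ring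
    rw [h1, Complex.norm_intCast]
    have : (1 : ℤ) ≤ |(k : ℤ) + 1 - n| := Int.one_le_abs (by omega)
    exact_mod_cast this
  -- Away from the resonance `n + 1 ≤ (k + 1) + |k + 1 - (n + 1)| ≤ (k + 2) |k + 1 - (n + 1)|`.
  -- Hence `p'` is summable too, and no derivative is lost.
  have hbound : ∀ n : ℕ, ‖a (n + 1) * (n + 1)‖ ≤ ((k : ℝ) + 2) * ‖coeff (n + 1) e‖ +
      (if n = k then ‖s * (k + 1)‖ else 0) := by
    intro n
    by_cases hn : n = k
    · subst hn
      simp [ha]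
      positivity
    · have hn' : n + 1 ≠ k + 1 := by omega
      simp only [ha, hn', hn, if_false, add_zero, norm_mul, norm_div]
      have h1 := hdist (n + 1) hn'
      have hpos : 0 < ‖(k : ℂ) + 1 - (n + 1 : ℕ)‖ := by linarith
      have h2 : ‖(n : ℂ) + 1‖ ≤ ((k : ℝ) + 2) * ‖(k : ℂ) + 1 - (n + 1 : ℕ)‖ := by
        have : ‖(n : ℂ) + 1‖ ≤ ‖(k : ℂ) + 1‖ + ‖(k : ℂ) + 1 - (n + 1 : ℕ)‖ := by
          have := norm_sub_le ((k : ℂ) + 1) ((k : ℂ) + 1 - (n + 1 : ℕ))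
          simpa [add_comm] using this
        have hk : ‖(k : ℂ) + 1‖ = k + 1 := by
          rw [← Nat.cast_succ, Complex.norm_natCast]; simp
        rw [hk] at this
        nlinarith
      rw [div_mul_eq_mul_div, div_le_iff₀ hpos]
      nlinarith [norm_nonneg (coeff (n + 1) e)]
  have hsum' : Summable fun n => ‖a (n + 1) * (n + 1)‖ := by
    refine Summable.of_nonneg_of_le (fun _ => norm_nonneg _) hbound ?_
    refine (((summable_nat_add_iff 1).2 (summable_coeff e)).mul_left _).add ?_
    exact summable_of_ne_finset_zero (s := {k}) fun n hn => by
      rw [Finset.mem_singleton] at hn; simp [hn]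
  have hsum : Summable fun n => ‖a n‖ := by
    rw [← summable_nat_add_iff 1]
    refine Summable.of_nonneg_of_le (fun _ => norm_nonneg _) (fun n => ?_) hsum'
    rw [norm_mul]
    refine le_mul_of_one_le_right (norm_nonneg _) ?_
    rw [← Nat.cast_succ, Complex.norm_natCast]
    simp
  have hder : IsDeriv (ofSeq a hsum) (ofSeq _ hsum') := isDeriv_of_coeff fun n => by simp
  refine ⟨ofSeq a hsum, ofSeq _ hsum', hder, ?_, by simp [ha]⟩
  refine ext_coeff fun n => ?_
  have hcast : ((k : 𝕎) + 1) = algebraMap ℂ 𝕎 ((k : ℂ) + 1) := by simp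
  rw [coeff_sub, hcast, coeff_algebraMap_mul, coeff_var_mul_of_isDeriv hder, ← sub_mul,
    coeff_ofSeq]
  by_cases hn : n = k + 1
  · subst hn
    simp [he]
  · have h1 := hdist n hn
    have : (k : ℂ) + 1 - n ≠ 0 := by
      intro h0
      rw [h0, norm_zero] at h1
      linarith
    simp only [ha, hn, if_false]
    field_simp

/-- The linearization of the conjugacy equation at the parabolic normal form, after the rescaling
`x ↦ r x`. -/
noncomputable def linearizedOp (k : ℕ) (μ d r : ℂ) (z : ℂ × 𝕎 × Param k) : 𝕎 :=
  Polynomial.aeval (r • var : 𝕎) (Polynomial.derivative (parabolicPoly k μ)) *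
      (r • (algebraMap ℂ 𝕎 z.1 + primitive z.2.1)) -
    Polynomial.aeval (r • var : 𝕎) (parabolicPoly k μ) * z.2.1 +
    Polynomial.aeval (r • var : 𝕎) (tangentPoly k d z.2.2)

section Linearized

variable {k : ℕ} (hk : 1 ≤ k) {μ d r : ℂ} (hr : r ≠ 0) {v : 𝕎}
  (hv : (1 - (μ * r ^ k) • var ^ k) * v = 1)

include hk in
lemma aeval_derivative_parabolicPoly :
    Polynomial.aeval (r • var : 𝕎) (Polynomial.derivative (parabolicPoly k μ)) * algebraMap ℂ 𝕎 r =
      algebraMap ℂ 𝕎 (r ^ (k + 1)) * var ^ k * (((k : 𝕎) + 1) * (1 - (μ * r ^ k) • var ^ k) +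
        var * (-(((k : ℂ) * (μ * r ^ k)) • var ^ (k - 1)))) := by
  -- With `k = i + 1` the truncated `k - 1` is the true exponent.
  obtain ⟨k, rfl⟩ : ∃ i, k = i + 1 := ⟨k - 1, by omega⟩
  have h2 : algebraMap ℂ 𝕎 2 = 2 := map_ofNat _ 2
  simp [parabolicPoly, Algebra.smul_def, h2]
  ring

lemma aeval_parabolicPoly :
    Polynomial.aeval (r • var : 𝕎) (parabolicPoly k μ) =
      algebraMap ℂ 𝕎 (r ^ (k + 1)) * var ^ (k + 1) * (1 - (μ * r ^ k) • var ^ k) := by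
  simp [parabolicPoly, Algebra.smul_def]
  ring

lemma aeval_tangentPoly (η : Param k) :
    Polynomial.aeval (r • var : 𝕎) (tangentPoly k d η) =
      (∑ j : Fin k, algebraMap ℂ 𝕎 (η.1 j * r ^ (j : ℕ)) * var ^ (j : ℕ)) *
        (1 - (d * r ^ k) • var ^ k) -
      algebraMap ℂ 𝕎 (η.2 * r ^ (2 * k + 1)) * var ^ (2 * k + 1) := by
  have hs : ∑ j : Fin k, algebraMap ℂ 𝕎 (η.1 j) * (r • var) ^ (j : ℕ) =
      ∑ j : Fin k, algebraMap ℂ 𝕎 (η.1 j * r ^ (j : ℕ)) * var ^ (j : ℕ) := by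
    refine Finset.sum_congr rfl fun j _ => ?_
    simp only [Algebra.smul_def, map_mul, map_pow]
    ring
  simp only [tangentPoly, map_sub, map_mul, map_sum, map_one, map_pow, Polynomial.aeval_C,
    Polynomial.aeval_X] at hs ⊢
  rw [hs]
  simp only [Algebra.smul_def, map_mul, map_pow]
  ring

include hk in
/-- The linearized operator in the coordinate `p = h / (1 - μ x^k)`. -/
lemma linearizedOp_eq {c : ℂ} {g p p' : 𝕎} (η : Param k)
    (hp : algebraMap ℂ 𝕎 c + primitive g = (1 - (μ * r ^ k) • var ^ k) * p)
    (hg : g = -(((k : ℂ) * (μ * r ^ k)) • var ^ (k - 1)) * p + (1 - (μ * r ^ k) • var ^ k) * p') :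
    linearizedOp k μ d r (c, g, η) = (1 - (μ * r ^ k) • var ^ k) ^ 2 *
        (algebraMap ℂ 𝕎 (r ^ (k + 1)) * var ^ k * (((k : 𝕎) + 1) * p - var * p')) +
      ((∑ j : Fin k, algebraMap ℂ 𝕎 (η.1 j * r ^ (j : ℕ)) * var ^ (j : ℕ)) *
        (1 - (d * r ^ k) • var ^ k) -
      algebraMap ℂ 𝕎 (η.2 * r ^ (2 * k + 1)) * var ^ (2 * k + 1)) := by
  -- For `X₀ = x^(k+1) u` and `h = u p` the terms containing the derivative of `u` cancel in `X₀' h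
  -- - X₀ h'`.
  rw [linearizedOp, aeval_tangentPoly, aeval_parabolicPoly]
  simp only [hp]
  rw [Algebra.smul_def r ((1 - (μ * r ^ k) • var ^ k) * p), ← mul_assoc,
    aeval_derivative_parabolicPoly hk, hg]
  ring

include hk in
lemma isDeriv_one_sub : IsDeriv (1 - (μ * r ^ k) • var ^ k)
    (-(((k : ℂ) * (μ * r ^ k)) • var ^ (k - 1))) := by
  obtain ⟨k, rfl⟩ : ∃ i, k = i + 1 := ⟨k - 1, by omega⟩
  unfold IsDeriv
  simp [Algebra.smul_def, mul_assoc]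
  ring

include hv in
-- Apply `v = 1 + μ r^k x^k v` twice. Division by `u²` therefore leaves the coefficients of degree
-- below `k` intact, whatever `d` is, so the `η_j` can be read off them.
lemma factor_eq_one_add : (1 - (d * r ^ k) • var ^ k) * v ^ 2 =
    1 + var ^ k * ((μ * r ^ k) • v + (μ * r ^ k) • v ^ 2 - (d * r ^ k) • v ^ 2) := by
  simp only [Algebra.smul_def] at *
  linear_combination (1 + v) * hv

include hk hv in
lemma coeff_zero_inv_sq : coeff 0 (v ^ 2) = 1 := by
  have h := factor_eq_one_add (d := 0) hv
  simp only [zero_mul, zero_smul, sub_zero, one_mul] at h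
  rw [h, coeff_add, coeff_var_pow_mul, coeff_one]
  simp [show ¬ k = 0 by omega]

include hk hr hv in
-- Division by `u²` separates the degrees: those below `k` give `η_j = 0`, degree `2k+1` gives
-- `η_{2k+1} = 0`, and the others kill `p` except in degree `k + 1`, where the normalization `h1`
-- does.
lemma linearizedOp_injective {z : ℂ × 𝕎 × Param k} (h0 : linearizedOp k μ d r z = 0)
    (h1 : coeff (k + 1) (v * (algebraMap ℂ 𝕎 z.1 + primitive z.2.1)) = 0) : z = 0 := by
  obtain ⟨c, g, η⟩ := z
  simp only at h1
  set u : 𝕎 := 1 - (μ * r ^ k) • var ^ k with hu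
  set u' : 𝕎 := -(((k : ℂ) * (μ * r ^ k)) • var ^ (k - 1)) with hu'
  set h : 𝕎 := algebraMap ℂ 𝕎 c + primitive g with hh
  set p : 𝕎 := v * h with hp
  set p' : 𝕎 := v * (g - u' * p) with hp'
  have hup : h = u * p := by rw [hp, ← mul_assoc, hv, one_mul]
  have hg : g = u' * p + u * p' := by rw [hp']; linear_combination (-g + u' * p) * hv
  clear_value p p'
  -- Differentiating `u p = h` formally gives `u D(p) = g - u' p`; multiply by `v`.
  have hder : IsDeriv p p' := by
    have hv2 : toPS u * toPS v = 1 := by rw [← map_mul, hv, map_one]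
    have e1 : IsDeriv u u' := isDeriv_one_sub hk
    have e2 : IsDeriv h g := isDeriv_const_add_primitive c g
    unfold IsDeriv at e1 e2 ⊢
    rw [hup, map_mul, Derivation.leibniz, e1] at e2
    simp only [smul_eq_mul] at e2
    rw [hp', map_mul, map_sub, map_mul, ← e2]
    linear_combination (-(PowerSeries.derivative ℂ) (toPS p)) * hv2
  rw [linearizedOp_eq hk (p := p) (p' := p') η hup hg] at h0
  set S : 𝕎 := ∑ j : Fin k, algebraMap ℂ 𝕎 (η.1 j * r ^ (j : ℕ)) * var ^ (j : ℕ) with hS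
  set E : 𝕎 := ((k : 𝕎) + 1) * p - var * p' with hE
  have hfac := factor_eq_one_add (d := d) hv
  set q : 𝕎 := (μ * r ^ k) • v + (μ * r ^ k) • v ^ 2 - (d * r ^ k) • v ^ 2 with hq
  -- The equation times `v² = u⁻²`: every term except `S` is now divisible by `x^k`, and `S` has
  -- degree below `k`.
  have key : var ^ k * (algebraMap ℂ 𝕎 (r ^ (k + 1)) * E + S * q -
      algebraMap ℂ 𝕎 (η.2 * r ^ (2 * k + 1)) * (var ^ (k + 1) * v ^ 2)) + S = 0 := by
    linear_combination v ^ 2 * h0 - S * hfac -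
      (algebraMap ℂ 𝕎 (r ^ (k + 1)) * var ^ k * E) * (1 + u * v) * hv
  have hη1 : η.1 = 0 := by
    ext j
    have hj := congrArg (coeff j) key
    rw [coeff_add, coeff_var_pow_mul, if_neg (by omega), hS, coeff_sum_var_pow, zero_add,
      coeff_zero] at hj
    simpa [hr] using hj
  have hS0 : S = 0 := by simp [hS, hη1]
  rw [hS0, add_zero, zero_mul, add_zero] at key
  have key2 := eq_zero_of_var_pow_mul_eq_zero key
  have hcast : ((k : 𝕎) + 1) = algebraMap ℂ 𝕎 ((k : ℂ) + 1) := by simp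
  have hEn : ∀ n, coeff n E = ((k : ℂ) + 1 - n) * coeff n p := fun n => by
    rw [hE, coeff_sub, hcast, coeff_algebraMap_mul, coeff_var_mul_of_isDeriv hder, ← sub_mul]
  -- In degree `k + 1` the Euler term vanishes, leaving only `η.2` up to a nonzero factor.
  have hη2 : η.2 = 0 := by
    have hn := congrArg (coeff (k + 1)) key2
    rw [coeff_sub, coeff_algebraMap_mul, coeff_algebraMap_mul, hEn, coeff_var_pow_mul,
      if_pos le_rfl, Nat.sub_self, coeff_zero_inv_sq hk hv, coeff_zero] at hn
    simpa [hr] using hn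
  rw [hη2, zero_mul, map_zero, zero_mul, sub_zero] at key2
  have hp0 : p = 0 := by
    refine ext_coeff fun n => ?_
    rw [coeff_zero]
    by_cases hn : n = k + 1
    · rw [hn, h1]
    · have h2 := congrArg (coeff n) key2
      rw [coeff_algebraMap_mul, hEn, coeff_zero] at h2
      have h3 : (k : ℂ) + 1 - n ≠ 0 := by
        intro h4
        apply hn
        have : (n : ℂ) = ((k + 1 : ℕ) : ℂ) := by push_cast; linear_combination -h4
        exact_mod_cast this
      simpa [hr, h3] using h2
  have hh0 : h = 0 := by rw [hup, hp0, mul_zero]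
  have hc : c = 0 := by
    have := coeff_zero_const_add_primitive c g
    rw [← hh, hh0, coeff_zero] at this
    exact this.symm
  have hg0 : g = 0 := by
    refine ext_coeff fun n => ?_
    have e2 : IsDeriv h g := isDeriv_const_add_primitive c g
    rw [e2.coeff, hh0]
    simp
  have hη : η = 0 := Prod.ext hη1 hη2
  rw [hc, hg0, hη]
  rfl

include hk hr hv in
-- The coefficients of `f / u²` below degree `k` determine `η₁`. After division by `x^k`, `η₂`
-- cancels the coefficient of degree `k + 1`, the only obstruction to the Euler equation, whose free
-- coefficient is then used to reach `s`.
lemma linearizedOp_surjective (f : 𝕎) (s : ℂ) : ∃ z : ℂ × 𝕎 × Param k,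
    linearizedOp k μ d r z = f ∧
      coeff (k + 1) (v * (algebraMap ℂ 𝕎 z.1 + primitive z.2.1)) = s := by
  set u : 𝕎 := 1 - (μ * r ^ k) • var ^ k with hu
  set u' : 𝕎 := -(((k : ℂ) * (μ * r ^ k)) • var ^ (k - 1)) with hu'
  have hfac := factor_eq_one_add (d := d) hv
  set q : 𝕎 := (μ * r ^ k) • v + (μ * r ^ k) • v ^ 2 - (d * r ^ k) • v ^ 2 with hq
  set η₁ : Fin k → ℂ := fun j => coeff j (f * v ^ 2) / r ^ (j : ℕ) with hη₁
  set S : 𝕎 := ∑ j : Fin k, algebraMap ℂ 𝕎 (η₁ j * r ^ (j : ℕ)) * var ^ (j : ℕ) with hS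
  obtain ⟨e, he⟩ : ∃ e, f * v ^ 2 - S * (1 + var ^ k * q) = var ^ k * e := by
    refine exists_eq_var_pow_mul fun j hj => ?_
    have h1 : S * (1 + var ^ k * q) = S + var ^ k * (S * q) := by ring
    have h2 := coeff_sum_var_pow (fun j => η₁ j * r ^ (j : ℕ)) ⟨j, hj⟩
    rw [← hS] at h2
    rw [h1, coeff_sub, coeff_add, coeff_var_pow_mul, if_neg (by omega), h2]
    simp [hη₁, hr]
  set η₂ : ℂ := -coeff (k + 1) e / r ^ (2 * k + 1) with hη₂
  set e₁ : 𝕎 := e + algebraMap ℂ 𝕎 (η₂ * r ^ (2 * k + 1)) * (var ^ (k + 1) * v ^ 2) with he₁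
  have he₁0 : coeff (k + 1) (algebraMap ℂ 𝕎 (r ^ (k + 1))⁻¹ * e₁) = 0 := by
    rw [coeff_algebraMap_mul, he₁, coeff_add, coeff_algebraMap_mul, coeff_var_pow_mul,
      if_pos le_rfl, Nat.sub_self, coeff_zero_inv_sq hk hv]
    simp [hη₂, hr]
  obtain ⟨p, p', hder, hE, hs⟩ := exists_euler_solution k _ he₁0 s
  have hh : u * p = algebraMap ℂ 𝕎 (coeff 0 (u * p)) + primitive (u' * p + u * p') :=
    eq_const_add_primitive ((isDeriv_one_sub hk).mul hder)
  refine ⟨(coeff 0 (u * p), u' * p + u * p', (η₁, η₂)), ?_, ?_⟩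
  · rw [linearizedOp_eq hk (p := p) (p' := p') (η₁, η₂) hh.symm rfl, hE]
    have hr1 : algebraMap ℂ 𝕎 (r ^ (k + 1)) * algebraMap ℂ 𝕎 (r ^ (k + 1))⁻¹ = 1 := by
      rw [← map_mul, mul_inv_cancel₀ (pow_ne_zero _ hr), map_one]
    have huv2 : u ^ 2 * v ^ 2 = 1 := by rw [← mul_pow, hv, one_pow]
    simp only [← hS, ← hu]
    linear_combination (u ^ 2 * var ^ k * e₁) * hr1 - u ^ 2 * he + u ^ 2 * S * hfac +
      (f - S * (1 - (d * r ^ k) • var ^ k) + algebraMap ℂ 𝕎 (η₂ * r ^ (2 * k + 1)) *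
        var ^ (2 * k + 1)) * huv2 + (u ^ 2 * var ^ k) * he₁
  · simp only [← hh]
    rw [← mul_assoc, mul_comm v, hv, one_mul, hs]

end Linearized

end WienerAlgebra

namespace WienerAlgebra

open VectorFieldFamily
open scoped ContDiff

local notation "𝕎" => WienerAlgebra

/-! ### The nonlinear conjugacy equation -/

/-- The displacement `h = c + ∫ g`. -/
noncomputable def displacement : ℂ × 𝕎 →L[ℂ] 𝕎 :=
  (Algebra.linearMap ℂ 𝕎).mkContinuous 1 (fun c => by simp [norm_algebraMap']) ∘L
      ContinuousLinearMap.fst ℂ ℂ 𝕎 + primitive ∘L ContinuousLinearMap.snd ℂ ℂ 𝕎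

lemma displacement_apply (c : ℂ) (g : 𝕎) :
    displacement (c, g) = algebraMap ℂ 𝕎 c + primitive g := by
  simp [displacement]

/-- The error in the conjugacy equation `X'(φ; y) = Ξ φ'` for the rescaled coordinate change
`φ(x) = r (x + c + ∫ g)`. -/
noncomputable def conjugacyDefect {k : ℕ} (P : Param k → Polynomial ℂ) (r : ℂ) (Ξ : 𝕎)
    (z : ℂ × 𝕎 × Param k) : 𝕎 :=
  Polynomial.aeval (r • (var + displacement (z.1, z.2.1))) (P z.2.2) - Ξ * (1 + z.2.1)

/-- The conjugacy equation together with a normalization of the coordinate change. -/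
noncomputable def normalizedDefect {k : ℕ} (P : Param k → Polynomial ℂ) (r : ℂ) (v : 𝕎)
    (w : (ℂ × 𝕎) × (ℂ × 𝕎 × Param k)) : 𝕎 × ℂ :=
  (conjugacyDefect P r w.1.2 w.2,
    coeffL (k + 1) (v * displacement (w.2.1, w.2.2.1)) - w.1.1)

lemma hasLineDerivAt_aeval (a δ : 𝕎) (p : Polynomial ℂ) :
    HasDerivAt (fun t : ℂ => Polynomial.aeval (a + t • δ) p)
      (Polynomial.aeval a (Polynomial.derivative p) * δ) 0 := by
  have hl : HasDerivAt (fun t : ℂ => a + t • δ) δ 0 := by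
    simpa using ((hasDerivAt_id (0 : ℂ)).smul_const δ).const_add a
  induction p using Polynomial.induction_on' with
  | add p q hp hq =>
    simp only [map_add, add_mul]
    exact hp.add hq
  | monomial n c =>
    have := (hl.fun_pow n).const_mul (algebraMap ℂ 𝕎 c)
    simp only [Polynomial.aeval_monomial, Polynomial.derivative_monomial]
    refine this.congr_deriv ?_
    simp
    ring

section

variable {k : ℕ} {P : Param k → Polynomial ℂ} {μ d r : ℂ} {v : 𝕎}

lemma contDiff_normalizedDefect
    (hP : ContDiff ℂ ω fun z : 𝕎 × Param k => Polynomial.aeval z.1 (P z.2)) :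
    ContDiff ℂ ω (normalizedDefect P r v) := by
  have h1 : ContDiff ℂ ω fun w : (ℂ × 𝕎) × (ℂ × 𝕎 × Param k) =>
      Polynomial.aeval (r • (var + displacement (w.2.1, w.2.2.1))) (P w.2.2.2) :=
    hP.comp (g := fun z : 𝕎 × Param k => Polynomial.aeval z.1 (P z.2))
      (f := fun w : (ℂ × 𝕎) × (ℂ × 𝕎 × Param k) =>
        (r • (var + displacement (w.2.1, w.2.2.1)), w.2.2.2)) (by fun_prop)
  unfold normalizedDefect conjugacyDefect
  fun_prop

lemma fderiv_aeval_fst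
    (hP : ContDiff ℂ ω fun z : 𝕎 × Param k => Polynomial.aeval z.1 (P z.2)) (a δ : 𝕎)
    (y : Param k) :
    fderiv ℂ (fun z : 𝕎 × Param k => Polynomial.aeval z.1 (P z.2)) (a, y) (δ, 0) =
      Polynomial.aeval a (Polynomial.derivative (P y)) * δ := by
  have h1 := (hP.differentiable (by simp) (a, y)).hasFDerivAt.hasLineDerivAt (δ, 0)
  have h2 := hasLineDerivAt_aeval a δ (P y)
  refine HasDerivAt.unique h1 ?_
  simpa using h2

/-- Since the map is differentiable, its derivative can be computed along a line through `w`. -/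
lemma fderiv_normalizedDefect
    (hP : ContDiff ℂ ω fun z : 𝕎 × Param k => Polynomial.aeval z.1 (P z.2))
    (w : (ℂ × 𝕎) × (ℂ × 𝕎 × Param k)) (c : ℂ) (g : 𝕎) (η : Param k) :
    fderiv ℂ (normalizedDefect P r v) w (0, (c, g, η)) =
      (Polynomial.aeval (r • (var + displacement (w.2.1, w.2.2.1)))
          (Polynomial.derivative (P w.2.2.2)) * (r • displacement (c, g)) - w.1.2 * g +
        fderiv ℂ (fun z : 𝕎 × Param k => Polynomial.aeval z.1 (P z.2))
          (r • (var + displacement (w.2.1, w.2.2.1)), w.2.2.2) (0, η),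
        coeffL (k + 1) (v * displacement (c, g))) := by
  obtain ⟨⟨s, Ξ⟩, c₀, g₀, y₀⟩ := w
  have h1 := ((contDiff_normalizedDefect (r := r) (v := v) hP).differentiable (by simp)
    ((s, Ξ), c₀, g₀, y₀)).hasFDerivAt.hasLineDerivAt (0, (c, g, η))
  refine HasDerivAt.unique h1 ?_
  have h2 := (hP.differentiable (by simp)
    (r • (var + displacement (c₀, g₀)), y₀)).hasFDerivAt.hasLineDerivAt (r • displacement (c, g), η)
  have h3 : HasDerivAt (fun t : ℂ => Ξ * (1 + (g₀ + t • g))) (Ξ * g) 0 := by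
    have : HasDerivAt (fun t : ℂ => 1 + (g₀ + t • g)) g 0 := by
      simpa using (((hasDerivAt_id (0 : ℂ)).smul_const g).const_add g₀).const_add 1
    exact this.const_mul Ξ
  have h4 : HasDerivAt (fun t : ℂ => coeffL (k + 1) (v * (displacement (c₀, g₀) +
      t • displacement (c, g))) - s) (coeffL (k + 1) (v * displacement (c, g))) 0 := by
    have : HasDerivAt (fun t : ℂ => displacement (c₀, g₀) + t • displacement (c, g))
        (displacement (c, g)) 0 := by
      simpa using ((hasDerivAt_id (0 : ℂ)).smul_const (displacement (c, g))).const_add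
        (displacement (c₀, g₀))
    exact (((coeffL (k + 1)).hasFDerivAt.comp_hasDerivAt (0 : ℂ)
      (this.const_mul v))).sub_const s
  have h5 : fderiv ℂ (fun z : 𝕎 × Param k => Polynomial.aeval z.1 (P z.2))
      (r • (var + displacement (c₀, g₀)), y₀) (r • displacement (c, g), η) =
      Polynomial.aeval (r • (var + displacement (c₀, g₀)))
          (Polynomial.derivative (P y₀)) * (r • displacement (c, g)) +
      fderiv ℂ (fun z : 𝕎 × Param k => Polynomial.aeval z.1 (P z.2))
          (r • (var + displacement (c₀, g₀)), y₀) (0, η) := by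
    rw [← fderiv_aeval_fst hP, ← map_add]
    simp
  rw [h5] at h2
  have h6 := (HasDerivAt.sub h2 h3).prodMk h4
  have hdisp : ∀ t : ℂ, displacement (c₀ + t * c, g₀ + t • g) =
      displacement (c₀, g₀) + t • displacement (c, g) := fun t => by
    rw [← map_smul, ← map_add]; simp
  refine HasDerivAt.congr_deriv (h6.congr_of_eventuallyEq (Eventually.of_forall fun t => ?_)) ?_
  · simp [normalizedDefect, conjugacyDefect, hdisp, smul_add, add_assoc, smul_comm t r]
  · simp only [Prod.mk.injEq, and_true]
    ring

lemma fderiv_normalizedDefect_fst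
    (hP : ContDiff ℂ ω fun z : 𝕎 × Param k => Polynomial.aeval z.1 (P z.2))
    (w : (ℂ × 𝕎) × (ℂ × 𝕎 × Param k)) :
    fderiv ℂ (normalizedDefect P r v) w ((1, 0), 0) = (0, -1) := by
  have h1 := ((contDiff_normalizedDefect (r := r) (v := v) hP).differentiable (by simp)
    w).hasFDerivAt.hasLineDerivAt ((1, 0), 0)
  refine HasDerivAt.unique h1 ?_
  have h2 := (hasDerivAt_const (0 : ℂ) (conjugacyDefect P r w.1.2 w.2)).prodMk
    (((hasDerivAt_id (0 : ℂ)).const_add w.1.1).const_sub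
      (coeffL (k + 1) (v * displacement (w.2.1, w.2.2.1))))
  refine h2.congr_of_eventuallyEq (Eventually.of_forall fun t => ?_)
  simp [normalizedDefect]

/-- At the base point this partial derivative is `linearizedOp` paired with the normalization, a
continuous bijection of Banach spaces; the inverse is continuous by the open mapping theorem. -/
lemma isInvertible_fderiv_normalizedDefect (hk : 1 ≤ k) (hr : r ≠ 0)
    (hv : (1 - (μ * r ^ k) • var ^ k) * v = 1)
    (hP : ContDiff ℂ ω fun z : 𝕎 × Param k => Polynomial.aeval z.1 (P z.2))
    (hP0 : P 0 = parabolicPoly k μ)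
    (hPd : ∀ (a : 𝕎) (η : Param k), HasDerivAt (fun t : ℂ => Polynomial.aeval a (P (t • η)))
      (Polynomial.aeval a (tangentPoly k d η)) 0) :
    (fderiv ℂ (normalizedDefect P r v)
      ((0, Polynomial.aeval (r • var : 𝕎) (parabolicPoly k μ)), 0) ∘L
        .inr ℂ (ℂ × 𝕎) (ℂ × 𝕎 × Param k)).IsInvertible := by
  set L := fderiv ℂ (normalizedDefect P r v)
      ((0, Polynomial.aeval (r • var : 𝕎) (parabolicPoly k μ)), 0) ∘L
        .inr ℂ (ℂ × 𝕎) (ℂ × 𝕎 × Param k) with hL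
  have hLz : ∀ z, L z = (linearizedOp k μ d r z,
      coeff (k + 1) (v * (algebraMap ℂ 𝕎 z.1 + primitive z.2.1))) := by
    rintro ⟨c, g, η⟩
    have h1 : fderiv ℂ (fun z : 𝕎 × Param k => Polynomial.aeval z.1 (P z.2))
        (r • var, 0) (0, η) = Polynomial.aeval (r • var : 𝕎) (tangentPoly k d η) := by
      have h1 := (hP.differentiable (by simp)
        (r • var, 0)).hasFDerivAt.hasLineDerivAt ((0 : 𝕎), η)
      refine HasDerivAt.unique h1 ?_
      simpa using hPd (r • var) η
    have h2 := fderiv_normalizedDefect (r := r) (v := v) hP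
      ((0, Polynomial.aeval (r • var : 𝕎) (parabolicPoly k μ)), 0) c g η
    have h3 : displacement (0, (0 : 𝕎)) = 0 := by
      rw [displacement_apply]; simp
    simp only [Prod.fst_zero, Prod.snd_zero, h3, add_zero, h1, hP0, displacement_apply] at h2
    exact h2
  have hker : LinearMap.ker (L : ℂ × 𝕎 × Param k →ₗ[ℂ] 𝕎 × ℂ) = ⊥ := by
    refine LinearMap.ker_eq_bot'.2 fun z hz => ?_
    have hz' : L z = 0 := hz
    rw [hLz] at hz'
    exact linearizedOp_injective hk hr hv (congrArg Prod.fst hz') (congrArg Prod.snd hz')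
  have hrange : LinearMap.range (L : ℂ × 𝕎 × Param k →ₗ[ℂ] 𝕎 × ℂ) = ⊤ := by
    refine LinearMap.range_eq_top.2 fun q => ?_
    obtain ⟨z, h1, h2⟩ := linearizedOp_surjective (d := d) hk hr hv q.1 q.2
    refine ⟨z, ?_⟩
    change L z = q
    rw [hLz, h1, h2]
  exact ⟨ContinuousLinearEquiv.ofBijective L hker hrange, by ext <;> rfl⟩

/-- The infinitesimal symmetry of a solution of the conjugacy equation given by the vector field
itself. -/
lemma fderiv_normalizedDefect_symmetry (hr : r ≠ 0)
    (hP : ContDiff ℂ ω fun z : 𝕎 × Param k => Polynomial.aeval z.1 (P z.2))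
    {w : (ℂ × 𝕎) × (ℂ × 𝕎 × Param k)} (hw : conjugacyDefect P r w.1.2 w.2 = 0) :
    ∃ K : ℂ × 𝕎 × Param k, K.2.2 = 0 ∧
      fderiv ℂ (normalizedDefect P r v) w (0, K) = (0, coeffL (k + 1) (v *
        (r⁻¹ • Polynomial.aeval (r • (var + displacement (w.2.1, w.2.2.1))) (P w.2.2.2)))) := by
  obtain ⟨⟨s, Ξ⟩, c, g, y⟩ := w
  simp only [conjugacyDefect] at hw ⊢
  set a : 𝕎 := r • (var + displacement (c, g)) with ha
  set A : 𝕎 := Polynomial.aeval a (P y) with hA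
  set A' : 𝕎 := Polynomial.aeval a (Polynomial.derivative (P y)) with hA'
  have hda : IsDeriv a (r • (1 + g)) := by
    have h1 : IsDeriv (displacement (c, g)) g := by
      rw [displacement_apply]; exact isDeriv_const_add_primitive c g
    unfold IsDeriv at *
    rw [ha, map_smul, map_add, toPS_var, Derivation.map_smul, map_add, h1, PowerSeries.derivative_X,
      map_smul, map_add, map_one]
  have hdA : IsDeriv (r⁻¹ • A) (A' * (1 + g)) := by
    have h1 := hda.aeval (P y)
    unfold IsDeriv at h1 ⊢
    rw [map_smul, Derivation.map_smul, h1, ← map_smul, mul_smul_comm, smul_smul,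
      inv_mul_cancel₀ hr, one_smul]
  have hdisp : displacement (coeff 0 (r⁻¹ • A), A' * (1 + g)) = r⁻¹ • A := by
    rw [displacement_apply]
    exact (eq_const_add_primitive hdA).symm
  -- The displacement is `h = X'(φ) / r`, the velocity of the flow of `X'` in the rescaled
  -- coordinate. The linearized equation becomes `A' (A - Ξ (1 + g)) = 0`, a multiple of the
  -- equation itself.
  refine ⟨(coeff 0 (r⁻¹ • A), A' * (1 + g), 0), rfl, ?_⟩
  rw [fderiv_normalizedDefect hP]
  simp only [hdisp, ← ha, ← hA', smul_smul, mul_inv_cancel₀ hr, one_smul]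
  have h0 : ((0 : 𝕎), (0 : Param k)) = 0 := rfl
  rw [h0, map_zero, add_zero]
  refine Prod.ext ?_ rfl
  change A' * A - Ξ * (A' * (1 + g)) = 0
  linear_combination A' * hw

/-- The conjugacy equation can be solved analytically, and the parameter part of the solution is
unique. -/
lemma exists_solution (hk : 1 ≤ k) (hr : r ≠ 0) (hμ : ‖μ * r ^ k‖ < 1)
    (hP : ContDiff ℂ ω fun z : 𝕎 × Param k => Polynomial.aeval z.1 (P z.2))
    (hP0 : P 0 = parabolicPoly k μ)
    (hPd : ∀ (a : 𝕎) (η : Param k), HasDerivAt (fun t : ℂ => Polynomial.aeval a (P (t • η)))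
      (Polynomial.aeval a (tangentPoly k d η)) 0) :
    ∃ Z : 𝕎 → ℂ × 𝕎 × Param k,
      AnalyticAt ℂ Z (Polynomial.aeval (r • var : 𝕎) (parabolicPoly k μ)) ∧
      Z (Polynomial.aeval (r • var : 𝕎) (parabolicPoly k μ)) = 0 ∧
      (∀ᶠ Ξ in 𝓝 (Polynomial.aeval (r • var : 𝕎) (parabolicPoly k μ)),
        conjugacyDefect P r Ξ (Z Ξ) = 0) ∧
      ∀ᶠ q : 𝕎 × (ℂ × 𝕎 × Param k) in 𝓝 (Polynomial.aeval (r • var : 𝕎) (parabolicPoly k μ), 0),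
        conjugacyDefect P r q.1 q.2 = 0 → q.2.2.2 = (Z q.1).2.2 := by
  set Ξ₀ : 𝕎 := Polynomial.aeval (r • var : 𝕎) (parabolicPoly k μ) with hΞ₀
  -- Neumann series; this is where `r` has to be small.
  obtain ⟨v, hv⟩ : ∃ v : 𝕎, (1 - (μ * r ^ k) • var ^ k) * v = 1 := by
    have hn : ‖(μ * r ^ k) • (var : 𝕎) ^ k‖ < 1 := by
      rw [norm_smul]
      refine lt_of_le_of_lt (mul_le_of_le_one_right (norm_nonneg _) ?_) hμ
      exact (norm_pow_le _ _).trans (by simp)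
    exact ⟨_, (Units.oneSub _ hn).mul_inv⟩
  set Φ := normalizedDefect P r v with hΦ
  have hΦc : ContDiff ℂ ω Φ := contDiff_normalizedDefect hP
  set u : (ℂ × 𝕎) × (ℂ × 𝕎 × Param k) := ((0, Ξ₀), 0) with hu
  have hdisp0 : displacement (0, (0 : 𝕎)) = 0 := by
    rw [displacement_apply]; simp
  have hΦu : Φ u = 0 := by
    simp [hΦ, hu, normalizedDefect, conjugacyDefect, hdisp0, hP0, hΞ₀]
  have hinv := isInvertible_fderiv_normalizedDefect hk hr hv hP hP0 hPd
  have hω : (ω : WithTop ℕ∞) ≠ 0 := by simp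
  set ζ := (hΦc.contDiffAt (x := u)).implicitFunction hω hinv with hζ
  have hζu : ζ (0, Ξ₀) = 0 := (hΦc.contDiffAt (x := u)).implicitFunction_apply_self hω hinv
  have hζc : ContDiffAt ℂ ω ζ (0, Ξ₀) :=
    (hΦc.contDiffAt (x := u)).contDiffAt_implicitFunction hω hinv
  have hζe : ∀ᶠ q in 𝓝 ((0 : ℂ), Ξ₀), Φ (q, ζ q) = 0 := by
    have := (hΦc.contDiffAt (x := u)).eventually_apply_implicitFunction hω hinv
    rwa [hΦu] at this
  have hζi : ∀ᶠ w in 𝓝 u, Φ w = 0 ↔ ζ w.1 = w.2 := by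
    have := (hΦc.contDiffAt (x := u)).eventually_apply_eq_iff_implicitFunction hω hinv
    rwa [hΦu] at this
  have hgraph : ContinuousAt (fun q : ℂ × 𝕎 => (q, ζ q)) (0, Ξ₀) :=
    continuousAt_id.prodMk hζc.continuousAt
  have hgrapht : Tendsto (fun q : ℂ × 𝕎 => (q, ζ q)) (𝓝 (0, Ξ₀)) (𝓝 u) := by
    have := hgraph.tendsto
    rwa [hζu] at this
  -- Invertible operators form an open set, so injectivity persists near `u`.
  have hinj : ∀ᶠ w in 𝓝 u, Function.Injective
      (fderiv ℂ Φ w ∘L .inr ℂ (ℂ × 𝕎) (ℂ × 𝕎 × Param k)) := by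
    have hc : Continuous fun w => fderiv ℂ Φ w ∘L .inr ℂ (ℂ × 𝕎) (ℂ × 𝕎 × Param k) :=
      (hΦc.continuous_fderiv (by simp)).clm_comp continuous_const
    obtain ⟨e, he⟩ := hinv
    have hn := ContinuousLinearEquiv.nhds e
    rw [he] at hn
    filter_upwards [hc.continuousAt.preimage_mem_nhds hn] with w hw
    obtain ⟨e', he'⟩ := hw
    change _ = fderiv ℂ Φ w ∘L .inr ℂ (ℂ × 𝕎) (ℂ × 𝕎 × Param k) at he'
    rw [← he']
    exact e'.injective
  -- The rate at which the symmetry changes the normalization.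
  set κ : (ℂ × 𝕎) × (ℂ × 𝕎 × Param k) → ℂ := fun w => coeffL (k + 1) (v *
    (r⁻¹ • Polynomial.aeval (r • (var + displacement (w.2.1, w.2.2.1))) (P w.2.2.2))) with hκ
  have hκ0 : ∀ᶠ w in 𝓝 u, κ w ≠ 0 := by
    have hcont : Continuous κ := by
      have h1 : Continuous fun w : (ℂ × 𝕎) × (ℂ × 𝕎 × Param k) =>
          Polynomial.aeval (r • (var + displacement (w.2.1, w.2.2.1))) (P w.2.2.2) :=
        hP.continuous.comp (g := fun z : 𝕎 × Param k => Polynomial.aeval z.1 (P z.2))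
          (f := fun w : (ℂ × 𝕎) × (ℂ × 𝕎 × Param k) =>
            (r • (var + displacement (w.2.1, w.2.2.1)), w.2.2.2)) (by fun_prop)
      rw [hκ]
      fun_prop
    refine hcont.continuousAt.eventually_ne ?_
    -- At the base point `v X₀ / r = r^k x^(k+1)`, so `κ u = r^k`.
    have h1 : κ u = coeff (k + 1) (algebraMap ℂ 𝕎 (r⁻¹ * r ^ (k + 1)) * (var ^ (k + 1) * 1)) := by
      simp only [hκ, hu, Prod.fst_zero, Prod.snd_zero, hdisp0, add_zero, hP0, coeffL_apply,
        aeval_parabolicPoly, Algebra.smul_def r⁻¹, map_mul]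
      congr 1
      linear_combination (algebraMap ℂ 𝕎 r⁻¹ * algebraMap ℂ 𝕎 (r ^ (k + 1)) * var ^ (k + 1)) * hv
    rw [h1, coeff_algebraMap_mul, coeff_var_pow_mul, if_pos le_rfl, Nat.sub_self, coeff_one]
    simp [hr]
  -- The parameter part of `ζ` does not depend on `s`: the `s`-derivative of `ζ` is a multiple of
  -- the symmetry `K`, which has no parameter component.
  have hconst : ∀ᶠ q in 𝓝 ((0 : ℂ), Ξ₀), (ζ q).2.2 = (ζ (0, q.2)).2.2 := by
    have hd : ∀ᶠ q in 𝓝 ((0 : ℂ), Ξ₀), HasDerivAt (fun s => (ζ (s, q.2)).2.2) 0 q.1 := by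
      have hζd : ∀ᶠ q in 𝓝 ((0 : ℂ), Ξ₀), DifferentiableAt ℂ ζ q :=
        (hζc.analyticAt.eventually_analyticAt).mono fun q hq => hq.differentiableAt
      filter_upwards [hζe.eventually_nhds, hζd, hgrapht.eventually hinj, hgrapht.eventually hκ0]
        with q h1 h2 h3 h4
      have h5 : HasDerivAt (fun s => ζ (s, q.2)) (fderiv ℂ ζ q (1, 0)) q.1 := by
        refine HasFDerivAt.comp_hasDerivAt (f := fun s => (s, q.2)) q.1 h2.hasFDerivAt ?_
        exact (hasDerivAt_id _).prodMk (hasDerivAt_const _ _)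
      have h6 : fderiv ℂ Φ (q, ζ q) ((1, 0), fderiv ℂ ζ q (1, 0)) = 0 := by
        have h7 : HasFDerivAt (fun q' => Φ (q', ζ q')) _ q :=
          HasFDerivAt.comp (f := fun q' => (q', ζ q')) q
            (hΦc.differentiable (by simp) (q, ζ q)).hasFDerivAt
            ((hasFDerivAt_id q).prodMk h2.hasFDerivAt)
        have h8 : HasFDerivAt (fun q' => Φ (q', ζ q'))
            (0 : (ℂ × 𝕎) →L[ℂ] 𝕎 × ℂ) q :=
          (hasFDerivAt_const (0 : 𝕎 × ℂ) q).congr_of_eventuallyEq h1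
        have h9 := congrArg (fun T => T (1, 0)) (h7.unique h8)
        simpa using h9
      obtain ⟨K, hK0, hK⟩ := fderiv_normalizedDefect_symmetry (v := v) hr hP (w := (q, ζ q))
        (congrArg Prod.fst h1.self_of_nhds)
      have h10 : fderiv ℂ Φ (q, ζ q) (0, fderiv ℂ ζ q (1, 0)) = (0, 1) := by
        have h11 := fderiv_normalizedDefect_fst (r := r) (v := v) hP (q, ζ q)
        rw [← hΦ] at h11
        have h12 : (((1, 0), fderiv ℂ ζ q (1, 0)) : (ℂ × 𝕎) × (ℂ × 𝕎 × Param k)) =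
          ((1, 0), 0) + (0, fderiv ℂ ζ q (1, 0)) := by simp
        rw [h12, map_add, h11] at h6
        have h13 := eq_neg_of_add_eq_zero_right h6
        rw [h13]
        simp
      have h14 : fderiv ℂ ζ q (1, 0) = (κ (q, ζ q))⁻¹ • K := by
        apply h3
        simp only [ContinuousLinearMap.comp_apply, ContinuousLinearMap.inr_apply]
        have h15 : ((0, (κ (q, ζ q))⁻¹ • K) : (ℂ × 𝕎) × (ℂ × 𝕎 × Param k)) =
          (κ (q, ζ q))⁻¹ • (0, K) := by simp
        rw [h10, h15, map_smul, hK]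
        change _ = (κ (q, ζ q))⁻¹ • (0, κ (q, ζ q))
        simp [h4]
      have h16 := ((ContinuousLinearMap.snd ℂ 𝕎 (Param k)) ∘L
        (ContinuousLinearMap.snd ℂ ℂ (𝕎 × Param k))).hasFDerivAt.comp_hasDerivAt q.1 h5
      rw [h14] at h16
      refine h16.congr_deriv ?_
      simp [hK0]
    obtain ⟨ε, hε, hball⟩ := Metric.eventually_nhds_iff_ball.1 hd
    refine Metric.eventually_nhds_iff_ball.2 ⟨ε, hε, fun q hq => ?_⟩
    -- In a product of balls, the slice at fixed `Ξ` is a disc in `s` that contains `0`, so a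
    -- vanishing derivative gives constancy up to `s = 0`.
    rw [← ball_prod_same] at hball hq
    have hd' : ∀ s ∈ Metric.ball (0 : ℂ) ε, HasDerivAt (fun s => (ζ (s, q.2)).2.2) 0 s :=
      fun s hs => hball (s, q.2) ⟨hs, hq.2⟩
    exact Metric.isOpen_ball.is_const_of_deriv_eq_zero (convex_ball _ _).isPreconnected
      (fun s hs => (hd' s hs).differentiableAt.differentiableWithinAt)
      (fun s hs => (hd' s hs).deriv) hq.1 (Metric.mem_ball_self hε)
  have hinr : Tendsto (fun Ξ : 𝕎 => ((0 : ℂ), Ξ)) (𝓝 Ξ₀) (𝓝 (0, Ξ₀)) :=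
    (Continuous.prodMk_right (0 : ℂ)).tendsto Ξ₀
  refine ⟨fun Ξ => ζ (0, Ξ), ?_, hζu, ?_, ?_⟩
  · exact hζc.analyticAt.fun_comp (g := ζ) (f := fun Ξ : 𝕎 => ((0 : ℂ), Ξ))
      (analyticAt_const.prod analyticAt_id)
  · filter_upwards [hinr.eventually hζe] with Ξ hΞ
    exact congrArg Prod.fst hΞ
  -- Any small solution equals `ζ (s, Ξ)` with `s` its own normalization; `hconst` then moves `s` to
  -- `0` without changing the parameter.
  · let S : 𝕎 × (ℂ × 𝕎 × Param k) → ℂ := fun q => coeffL (k + 1) (v * displacement (q.2.1, q.2.2.1))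
    have hS : Continuous S := by fun_prop
    have hS0 : S (Ξ₀, 0) = 0 := by simp [S, hdisp0]
    have ht1 : Tendsto (fun q : 𝕎 × (ℂ × 𝕎 × Param k) => ((S q, q.1), q.2)) (𝓝 (Ξ₀, 0)) (𝓝 u) := by
      have : Continuous fun q : 𝕎 × (ℂ × 𝕎 × Param k) => ((S q, q.1), q.2) := by fun_prop
      have := this.tendsto (Ξ₀, 0)
      rwa [hS0] at this
    have ht2 : Tendsto (fun q : 𝕎 × (ℂ × 𝕎 × Param k) => (S q, q.1)) (𝓝 (Ξ₀, 0))
        (𝓝 (0, Ξ₀)) := by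
      have : Continuous fun q : 𝕎 × (ℂ × 𝕎 × Param k) => (S q, q.1) := by fun_prop
      have := this.tendsto (Ξ₀, 0)
      rwa [hS0] at this
    filter_upwards [ht1.eventually hζi, ht2.eventually hconst] with q h1 h2 h3
    have h4 : Φ ((S q, q.1), q.2) = 0 := by
      refine Prod.ext h3 ?_
      simp [hΦ, normalizedDefect, S]
    have h5 := h1.1 h4
    change ζ (S q, q.1) = q.2 at h5
    change (ζ (S q, q.1)).2.2 = _ at h2
    rw [← h2, h5]

end

end WienerAlgebra

/-! ### Passage between germs of conjugacies and solutions in the Wiener algebra -/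

namespace VectorFieldFamily

open WienerAlgebra
open scoped ContDiff

local notation "𝕎" => WienerAlgebra

lemma eval_aeval {x : ℂ} (hx : ‖x‖ ≤ 1) (a : 𝕎) (p : Polynomial ℂ) :
    eval x (Polynomial.aeval a p) = p.eval (eval x a) := by
  rw [← evalHom_apply x hx, ← Polynomial.aeval_algHom_apply, Polynomial.coe_aeval_eq_eval]
  rfl

lemma eval_zero (x : ℂ) : eval x (0 : 𝕎) = 0 := by
  simp [eval]

lemma eval_conjugacyDefect {k : ℕ} (P : Param k → Polynomial ℂ) (r : ℂ) (Ξ : 𝕎) (c : ℂ) (g : 𝕎)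
    (y : Param k) {x : ℂ} (hx : ‖x‖ ≤ 1) :
    eval x (conjugacyDefect P r Ξ (c, g, y)) =
      (P y).eval (r * x + r * eval x (displacement (c, g))) - eval x Ξ * (1 + eval x g) := by
  rw [conjugacyDefect, ← evalHom_apply x hx, map_sub, map_mul, map_add, map_one]
  simp only [evalHom_apply]
  rw [eval_aeval hx, eval_smul, eval_add hx, eval_var, mul_add]

lemma eval_displacement {x : ℂ} (hx : ‖x‖ ≤ 1) (c : ℂ) (g : 𝕎) :
    eval x (displacement (c, g)) = c + eval x (primitive g) := by
  rw [displacement_apply, eval_add hx, Algebra.algebraMap_eq_smul_one, eval_smul, eval_one, mul_one]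

lemma hasDerivAt_eval_displacement {x : ℂ} (hx : ‖x‖ < 1) (c : ℂ) (g : 𝕎) :
    HasDerivAt (fun z => eval z (displacement (c, g))) (eval x g) x := by
  have h1 := (hasDerivAt_eval_primitive g hx).const_add c
  refine h1.congr_of_eventuallyEq ?_
  have : ∀ᶠ z in 𝓝 x, ‖z‖ < 1 := continuous_norm.continuousAt.eventually_lt continuousAt_const hx
  filter_upwards [this] with z hz
  exact eval_displacement hz.le c g

lemma eventually_norm_mul_pow_lt_one {k : ℕ} (hk : 1 ≤ k) (μ : ℂ) :
    ∀ᶠ r : ℂ in 𝓝 0, ‖μ * r ^ k‖ < 1 := by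
  have : ContinuousAt (fun r : ℂ => ‖μ * r ^ k‖) 0 := by fun_prop
  exact this.eventually_lt continuousAt_const (by simp [show k ≠ 0 by omega])

lemma tendsto_mul_left_zero (r : ℂ) : Tendsto (fun x : ℂ => r * x) (𝓝 0) (𝓝 0) := by
  simpa using (continuous_const_mul r).tendsto 0

section

variable {k m : ℕ} {P : Param k → Polynomial ℂ} {X' : ℂ → Param k → ℂ} {μ d : ℂ}

lemma eq_aeval_parabolicPoly {Ξ : 𝕎} {r : ℂ}
    (h : ∀ᶠ x in 𝓝 (0 : ℂ), eval x Ξ = parabolicNormalForm k μ (r * x)) :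
    Ξ = Polynomial.aeval (r • var : 𝕎) (parabolicPoly k μ) := by
  refine eq_of_eventually_eval_eq ?_
  have h1 : ∀ᶠ x : ℂ in 𝓝 0, ‖x‖ < 1 :=
    continuous_norm.continuousAt.eventually_lt continuousAt_const (by simp)
  filter_upwards [h, h1] with x hx hx1
  rw [hx, eval_aeval hx1.le, eval_smul, eval_var]
  simp [parabolicPoly, parabolicNormalForm]

/-- A coordinate change conjugating `X` to an induced family gives solutions of the conjugacy
equation in the Wiener algebra. -/
lemma exists_solution_of_isConjugacy (hX' : ∀ x y, X' x y = (P y).eval x)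
    {X φ : ℂ → (Fin m → ℂ) → ℂ} {ψ : (Fin m → ℂ) → Param k}
    (hφ : IsConjugacy φ X (induced ψ X')) (hφ0 : ∀ᶠ x in 𝓝 (0 : ℂ), φ x 0 = x) :
    ∀ᶠ r : ℂ in 𝓝[≠] 0, ∃ (c : (Fin m → ℂ) → ℂ) (g : (Fin m → ℂ) → 𝕎),
      ContinuousAt c 0 ∧ ContinuousAt g 0 ∧ c 0 = 0 ∧ g 0 = 0 ∧
      ∀ᶠ l in 𝓝 (0 : Fin m → ℂ), ∀ Ξ : 𝕎, (∀ᶠ x in 𝓝 (0 : ℂ), eval x Ξ = X (r * x) l) →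
        conjugacyDefect P r Ξ (c l, g l, ψ l) = 0 := by
  obtain ⟨hφa, hφ00, -, hconj⟩ := hφ
  have hpart : ∀ p : ℂ × (Fin m → ℂ), AnalyticAt ℂ (fun p : ℂ × (Fin m → ℂ) => φ p.1 p.2) p →
      HasDerivAt (fun x => φ x p.2)
        (fderiv ℂ (fun p : ℂ × (Fin m → ℂ) => φ p.1 p.2) p (1, 0)) p.1 := fun p hp =>
    hp.differentiableAt.hasFDerivAt.comp_hasDerivAt (f := fun x => (x, p.2)) p.1
      ((hasDerivAt_id _).prodMk (hasDerivAt_const _ _))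
  -- The future `g` is `∂φ/∂x - 1`; it is jointly analytic because `∂φ/∂x` is a component of the
  -- Fréchet derivative of `φ`.
  have hda : AnalyticAt ℂ (fun p : ℂ × (Fin m → ℂ) => deriv (fun x => φ x p.2) p.1 - 1)
      (0, 0) := by
    have h1 : AnalyticAt ℂ (fun p => fderiv ℂ (fun p : ℂ × (Fin m → ℂ) => φ p.1 p.2) p (1, 0))
        (0, 0) :=
      ((ContinuousLinearMap.apply ℂ ℂ ((1, 0) : ℂ × (Fin m → ℂ))).analyticAt _).fun_comp hφa.fderiv
    refine (h1.fun_sub (analyticAt_const (v := (1 : ℂ)))).congr ?_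
    filter_upwards [hφa.eventually_analyticAt] with p hp
    rw [(hpart p hp).deriv]
  filter_upwards [nhdsWithin_le_nhds (exists_analytic_family hda), self_mem_nhdsWithin]
    with r ⟨g, hg, hge⟩ hr
  have hr : r ≠ 0 := hr
  have hφ0c : ContinuousAt (fun l : Fin m → ℂ => φ 0 l / r) 0 := by
    have : ContinuousAt (fun l : Fin m → ℂ => φ 0 l) 0 :=
      ContinuousAt.comp (g := fun p : ℂ × (Fin m → ℂ) => φ p.1 p.2)
        (f := fun l : Fin m → ℂ => ((0 : ℂ), l)) hφa.continuousAt (by fun_prop)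
    exact this.div_const r
  have hsmall : ∀ᶠ x : ℂ in 𝓝 0, ‖x‖ < 1 :=
    continuous_norm.continuousAt.eventually_lt continuousAt_const (by simp)
  refine ⟨fun l => φ 0 l / r, g, hφ0c, hg.continuousAt, by simp [hφ00], ?_, ?_⟩
  · refine eq_of_eventually_eval_eq ?_
    filter_upwards [hsmall, (tendsto_mul_left_zero r).eventually hφ0.eventually_nhds] with x hx h1
    rw [hge.self_of_nhds x hx.le, eval_zero]
    have h2 : HasDerivAt (fun z => φ z 0) 1 (r * x) :=
      (hasDerivAt_id _).congr_of_eventuallyEq h1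
    simp [h2.deriv]
  · obtain ⟨ε, hε, hball⟩ := Metric.eventually_nhds_iff_ball.1 (hφa.eventually_analyticAt.and hconj)
    rw [← ball_prod_same] at hball
    filter_upwards [hge, Metric.ball_mem_nhds _ hε] with l hl hlε Ξ hΞ
    obtain ⟨δ, hδ, hδball⟩ := Metric.eventually_nhds_iff_ball.1
      (hsmall.and ((tendsto_mul_left_zero r).eventually (Metric.ball_mem_nhds _ hε)))
    -- On a small disc `φ(r x; l)` and `r (x + h(x))` have the same derivative and agree at `0`, so
    -- they coincide there.
    have hder : ∀ x ∈ Metric.ball (0 : ℂ) δ, HasDerivAt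
        (fun x => φ (r * x) l - (r * x + r * eval x (displacement (φ 0 l / r, g l)))) 0 x := by
      intro x hx
      obtain ⟨hx1, hxε⟩ := hδball x hx
      have h1 := hpart (r * x, l) (hball (r * x, l) ⟨hxε, hlε⟩).1
      have h2 : HasDerivAt (fun x : ℂ => r * x) r x := by
        simpa using (hasDerivAt_id x).const_mul r
      have h3 := HasDerivAt.comp x (h₂ := fun x => φ x l) (h := fun x => r * x) h1 h2
      have h4 := (hasDerivAt_eval_displacement hx1 (φ 0 l / r) (g l)).const_mul r
      refine (h3.sub (h2.add h4)).congr_deriv ?_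
      rw [hl x hx1.le]
      simp only [h1.deriv]
      ring
    have heq : ∀ x ∈ Metric.ball (0 : ℂ) δ,
        φ (r * x) l = r * x + r * eval x (displacement (φ 0 l / r, g l)) := by
      intro x hx
      have h1 := Metric.isOpen_ball.is_const_of_deriv_eq_zero
        (convex_ball (0 : ℂ) δ).isPreconnected
        (fun s hs => (hder s hs).differentiableAt.differentiableWithinAt)
        (fun s hs => (hder s hs).deriv) hx (Metric.mem_ball_self hδ)
      have h2 : eval 0 (displacement (φ 0 l / r, g l)) = φ 0 l / r := by
        rw [eval_displacement (by simp), eval_zero_primitive, add_zero]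
      simp only [h2, mul_zero, zero_add, mul_div_cancel₀ _ hr, sub_self] at h1
      exact sub_eq_zero.1 h1
    -- An element of the algebra is determined by its germ, so checking the equation near `0` is
    -- enough.
    refine eq_of_eventually_eval_eq ?_
    filter_upwards [hΞ, Metric.ball_mem_nhds _ hδ] with x hx hxδ
    obtain ⟨hx1, hxε⟩ := hδball x hxδ
    rw [eval_conjugacyDefect _ _ _ _ _ _ hx1.le, ← heq x hxδ, hx, hl x hx1.le, eval_zero, ← hX']
    have := (hball (r * x, l) ⟨hxε, hlε⟩).2
    simp only [induced] at this
    rw [this]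
    ring

/-- Of the family only polynomiality in `x`, analyticity in `y` and the first-order jet at `y = 0`
matter, which lets one argument serve both normal forms. -/
theorem isVersalDeformation (hk : 1 ≤ k) (hX' : ∀ x y, X' x y = (P y).eval x)
    (hdef : IsDeformation X' (parabolicNormalForm k μ))
    (hP : ContDiff ℂ ω fun z : 𝕎 × Param k => Polynomial.aeval z.1 (P z.2))
    (hP0 : P 0 = parabolicPoly k μ)
    (hPd : ∀ (a : 𝕎) (η : Param k), HasDerivAt (fun t : ℂ => Polynomial.aeval a (P (t • η)))
      (Polynomial.aeval a (tangentPoly k d η)) 0) :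
    IsVersalDeformation X' (parabolicNormalForm k μ) := by
  refine ⟨hdef, fun m X ⟨hXa, hX0⟩ => ?_⟩
  obtain ⟨r, ⟨⟨S, hSa, hSe⟩, hμ⟩, hr⟩ := ((((exists_analytic_family hXa).and
    (eventually_norm_mul_pow_lt_one hk μ)).filter_mono nhdsWithin_le_nhds).and
      (self_mem_nhdsWithin (a := (0 : ℂ)) (s := {0}ᶜ))).exists
  have hr : r ≠ 0 := hr
  have hsmall : ∀ᶠ x : ℂ in 𝓝 0, ‖x‖ < 1 :=
    continuous_norm.continuousAt.eventually_lt continuousAt_const (by simp)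
  have hS0 : S 0 = Polynomial.aeval (r • var : 𝕎) (parabolicPoly k μ) := by
    refine eq_aeval_parabolicPoly ?_
    filter_upwards [hsmall, (tendsto_mul_left_zero r).eventually hX0] with x hx1 hx2
    rw [hSe.self_of_nhds x hx1.le]
    exact hx2
  obtain ⟨Z, hZa, hZ0, hZ, -⟩ := exists_solution hk hr hμ hP hP0 hPd
  rw [← hS0] at hZa hZ0 hZ
  have hZS : AnalyticAt ℂ (fun l => Z (S l)) 0 := hZa.fun_comp hSa
  have hψ : AnalyticAt ℂ (fun l => (Z (S l)).2.2) 0 :=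
    (((ContinuousLinearMap.snd ℂ 𝕎 (Param k)) ∘L
        (ContinuousLinearMap.snd ℂ ℂ (𝕎 × Param k))).analyticAt _).fun_comp hZS
  have hh : AnalyticAt ℂ (fun l => displacement ((Z (S l)).1, (Z (S l)).2.1)) 0 := by
    refine (displacement.analyticAt _).fun_comp (f := fun l => ((Z (S l)).1, (Z (S l)).2.1)) ?_
    refine AnalyticAt.prod ?_ ?_
    · exact ((ContinuousLinearMap.fst ℂ ℂ (𝕎 × Param k)).analyticAt _).fun_comp hZS
    · exact (((ContinuousLinearMap.fst ℂ 𝕎 (Param k)) ∘L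
        (ContinuousLinearMap.snd ℂ ℂ (𝕎 × Param k))).analyticAt _).fun_comp hZS
  have hh0 : displacement ((Z (S 0)).1, (Z (S 0)).2.1) = 0 := by
    rw [hZ0]; exact map_zero displacement
  -- The solution for the field `S l`, with the rescaling `x ↦ r x` undone.
  set φ : ℂ → (Fin m → ℂ) → ℂ := fun x l =>
    x + r * eval (x / r) (displacement ((Z (S l)).1, (Z (S l)).2.1)) with hφ
  have hφ0 : ∀ x, φ x 0 = x := fun x => by simp [hφ, hh0, eval_zero]
  refine ⟨fun l => (Z (S l)).2.2, hψ, by simp [hZ0], φ, ⟨?_, hφ0 0, ?_, ?_⟩,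
    Eventually.of_forall hφ0⟩
  · refine analyticAt_fst.fun_add (analyticAt_const.fun_mul ?_)
    have h0 : ((0 : ℂ), (0 : 𝕎)) = ((0 : ℂ) / r, displacement ((Z (S 0)).1, (Z (S 0)).2.1)) := by
      rw [hh0, zero_div]
    have h1 := analyticAt_eval (0 : 𝕎)
    rw [h0] at h1
    refine AnalyticAt.fun_comp (g := fun p : ℂ × 𝕎 => eval p.1 p.2)
      (f := fun p : ℂ × (Fin m → ℂ) => (p.1 / r, displacement ((Z (S p.2)).1, (Z (S p.2)).2.1)))
      h1 ?_
    refine AnalyticAt.prod ?_ ?_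
    · exact analyticAt_fst.fun_div analyticAt_const hr
    · exact AnalyticAt.fun_comp (g := fun l => displacement ((Z (S l)).1, (Z (S l)).2.1))
        (f := Prod.snd) hh analyticAt_snd
  · simp [hφ0]
  · have h1 : ∀ᶠ x : ℂ in 𝓝 0, ‖x / r‖ < 1 := by
      have : ContinuousAt (fun x : ℂ => ‖x / r‖) 0 := by fun_prop
      exact this.eventually_lt continuousAt_const (by simp)
    filter_upwards [prod_mem_nhds h1 (hSe.and (hSa.continuousAt.eventually hZ))] with p hp
    obtain ⟨x, l⟩ := p
    obtain ⟨hx, hl1, hl2⟩ := hp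
    have hx : ‖x / r‖ < 1 := hx
    have h2 := congrArg (eval (x / r)) hl2
    have h3 := eval_conjugacyDefect P r (S l) (Z (S l)).1 (Z (S l)).2.1 (Z (S l)).2.2 hx.le
    have h4 : HasDerivAt (fun x => φ x l) (1 + eval (x / r) (Z (S l)).2.1) x := by
      have h5 : HasDerivAt (fun x : ℂ => x / r) (1 / r) x := (hasDerivAt_id x).div_const r
      have h6 := (HasDerivAt.comp x (h₂ := fun z => eval z (displacement ((Z (S l)).1,
        (Z (S l)).2.1))) (h := fun x => x / r)
        (hasDerivAt_eval_displacement hx (Z (S l)).1 (Z (S l)).2.1) h5).const_mul r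
      refine ((hasDerivAt_id x).add h6).congr_deriv ?_
      field_simp
    rw [h4.deriv]
    change eval (x / r) (conjugacyDefect P r (S l) ((Z (S l)).1, (Z (S l)).2.1, (Z (S l)).2.2)) = _
      at h2
    rw [h3, eval_zero, hl1 _ hx.le, mul_div_cancel₀ _ hr] at h2
    simp only [induced, hX', hφ]
    exact sub_eq_zero.1 h2

/-- An inducing map together with its conjugacy yields a solution that tends to the base point as `l
→ 0`; by local uniqueness its parameter is that of `Z (S l)`, the same for every inducing map. -/
theorem isUniversalDeformation (hk : 1 ≤ k) (hX' : ∀ x y, X' x y = (P y).eval x)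
    (hdef : IsDeformation X' (parabolicNormalForm k μ))
    (hP : ContDiff ℂ ω fun z : 𝕎 × Param k => Polynomial.aeval z.1 (P z.2))
    (hP0 : P 0 = parabolicPoly k μ)
    (hPd : ∀ (a : 𝕎) (η : Param k), HasDerivAt (fun t : ℂ => Polynomial.aeval a (P (t • η)))
      (Polynomial.aeval a (tangentPoly k d η)) 0) :
    IsUniversalDeformation X' (parabolicNormalForm k μ) := by
  refine ⟨isVersalDeformation hk hX' hdef hP hP0 hPd, ?_⟩
  rintro m X ⟨hXa, hX0⟩ ψ₁ ψ₂ ⟨hψ₁, hψ₁0, φ₁, hφ₁, hφ₁0⟩ ⟨hψ₂, hψ₂0, φ₂, hφ₂, hφ₂0⟩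
  -- Each condition holds for all small nonzero `r`, so one `r` serves the deformation and both
  -- conjugacies.
  obtain ⟨r, ⟨⟨⟨⟨S, hSa, hSe⟩, hμ⟩, hr⟩, c₁, g₁, hc₁, hg₁, hc₁0, hg₁0, h₁⟩,
    c₂, g₂, hc₂, hg₂, hc₂0, hg₂0, h₂⟩ := (((((exists_analytic_family hXa).and
    (eventually_norm_mul_pow_lt_one hk μ)).filter_mono nhdsWithin_le_nhds).and
      (self_mem_nhdsWithin (a := (0 : ℂ)) (s := {0}ᶜ))).and
      (exists_solution_of_isConjugacy hX' hφ₁ hφ₁0) |>.and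
      (exists_solution_of_isConjugacy hX' hφ₂ hφ₂0)).exists
  have hr : r ≠ 0 := hr
  have hsmall : ∀ᶠ x : ℂ in 𝓝 0, ‖x‖ < 1 :=
    continuous_norm.continuousAt.eventually_lt continuousAt_const (by simp)
  have hS0 : S 0 = Polynomial.aeval (r • var : 𝕎) (parabolicPoly k μ) := by
    refine eq_aeval_parabolicPoly ?_
    filter_upwards [hsmall, (tendsto_mul_left_zero r).eventually hX0] with x hx1 hx2
    rw [hSe.self_of_nhds x hx1.le]
    exact hx2
  obtain ⟨Z, -, -, -, hZ⟩ := exists_solution hk hr hμ hP hP0 hPd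
  rw [← hS0] at hZ
  have key : ∀ (c : (Fin m → ℂ) → ℂ) (g : (Fin m → ℂ) → 𝕎) (ψ : (Fin m → ℂ) → Param k),
      ContinuousAt c 0 → ContinuousAt g 0 → ContinuousAt ψ 0 → c 0 = 0 → g 0 = 0 → ψ 0 = 0 →
      (∀ᶠ l in 𝓝 (0 : Fin m → ℂ), ∀ Ξ : 𝕎, (∀ᶠ x in 𝓝 (0 : ℂ), eval x Ξ = X (r * x) l) →
        conjugacyDefect P r Ξ (c l, g l, ψ l) = 0) →
      ∀ᶠ l in 𝓝 (0 : Fin m → ℂ), ψ l = (Z (S l)).2.2 := by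
    intro c g ψ hc hg hψ hc0 hg0 hψ0 h
    have ht : Tendsto (fun l => (S l, c l, g l, ψ l)) (𝓝 0) (𝓝 (S 0, 0)) := by
      have h1 : ContinuousAt (fun l => (S l, c l, g l, ψ l)) 0 :=
        hSa.continuousAt.prodMk (hc.prodMk (hg.prodMk hψ))
      have h2 := h1.tendsto
      rw [hc0, hg0, hψ0] at h2
      exact h2
    filter_upwards [ht.eventually hZ, h, hSe] with l h3 h4 h5
    exact h3 (h4 (S l) (hsmall.mono fun x hx => h5 x hx.le))
  filter_upwards [key c₁ g₁ ψ₁ hc₁ hg₁ hψ₁.continuousAt hc₁0 hg₁0 hψ₁0 h₁,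
    key c₂ g₂ ψ₂ hc₂ hg₂ hψ₂.continuousAt hc₂0 hg₂0 hψ₂0 h₂] with l e₁ e₂
  rw [e₁, e₂]

end

/-! ### The two explicit families -/

/-- Along a line `t • η` of parameters both families are polynomials in `t` of degree at most two.
-/
lemma hasDerivAt_quadratic (A B C : 𝕎) :
    HasDerivAt (fun t : ℂ => A + t • B + t ^ 2 • C) B 0 := by
  have h1 : HasDerivAt (fun t : ℂ => t • B) B 0 := by
    simpa using (hasDerivAt_id (0 : ℂ)).smul_const B
  have h2 : HasDerivAt (fun t : ℂ => t ^ 2 • C) 0 0 := by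
    simpa using (hasDerivAt_pow 2 (0 : ℂ)).smul_const C
  simpa using (h1.const_add A).fun_add h2

open Polynomial in
/-- `x^(k+1) + y_{k-1} x^(k-1) + … + y_0` as a polynomial in `x`. -/
noncomputable def unfoldingPolynomial (k : ℕ) (y : Param k) : ℂ[X] :=
  X ^ (k + 1) + ∑ j : Fin k, C (y.1 j) * X ^ (j : ℕ)

lemma eval_unfoldingPolynomial (k : ℕ) (y : Param k) (x : ℂ) :
    (unfoldingPolynomial k y).eval x = unfoldingPoly k x y := by
  simp [unfoldingPolynomial, unfoldingPoly, Polynomial.eval_finsetSum]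

lemma aeval_unfoldingPolynomial (k : ℕ) (y : Param k) (a : 𝕎) :
    Polynomial.aeval a (unfoldingPolynomial k y) =
      a ^ (k + 1) + ∑ j : Fin k, y.1 j • a ^ (j : ℕ) := by
  simp [unfoldingPolynomial, Algebra.smul_def]

lemma aeval_tangentPoly_smul (k : ℕ) (d : ℂ) (η : Param k) (a : 𝕎) :
    Polynomial.aeval a (tangentPoly k d η) =
      (∑ j : Fin k, η.1 j • a ^ (j : ℕ)) * (1 - d • a ^ k) - η.2 • a ^ (2 * k + 1) := by
  simp [tangentPoly, Algebra.smul_def]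

lemma contDiff_aeval_unfoldingPolynomial (k : ℕ) :
    ContDiff ℂ ω fun z : 𝕎 × Param k => Polynomial.aeval z.1 (unfoldingPolynomial k z.2) := by
  simp only [aeval_unfoldingPolynomial]
  fun_prop

lemma sum_smul_param {k : ℕ} (t : ℂ) (η : Param k) (a : 𝕎) :
    ∑ j : Fin k, (t • η).1 j • a ^ (j : ℕ) = t • ∑ j : Fin k, η.1 j • a ^ (j : ℕ) := by
  simp [Finset.smul_sum, mul_smul]

lemma unfoldingPolynomial_zero (k : ℕ) :
    unfoldingPolynomial k 0 = Polynomial.X ^ (k + 1) := by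
  simp [unfoldingPolynomial]

lemma contDiff_unfoldingPoly (k : ℕ) :
    ContDiff ℂ ω fun p : ℂ × Param k => unfoldingPoly k p.1 p.2 := by
  unfold unfoldingPoly
  fun_prop

/-- The family is affine in `y`, and its first-order part corresponds to `d = 0`. -/
lemma isUniversalDeformation_kostovX1 {k : ℕ} (hk : 1 ≤ k) (μ : ℂ) :
    IsUniversalDeformation (kostovX1 k μ) (parabolicNormalForm k μ) := by
  refine isUniversalDeformation (d := 0) (P := fun y => unfoldingPolynomial k y -
    Polynomial.C (μ + y.2) * Polynomial.X ^ (2 * k + 1)) hk ?_ ⟨?_, ?_⟩ ?_ ?_ ?_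
  · intro x y
    simp [kostovX1, eval_unfoldingPolynomial]
  · have h1 := contDiff_unfoldingPoly k
    have : ContDiff ℂ ω fun p : ℂ × Param k => kostovX1 k μ p.1 p.2 := by
      unfold kostovX1
      fun_prop
    exact this.contDiffAt.analyticAt
  · exact Eventually.of_forall fun x => by simp [kostovX1, unfoldingPoly, parabolicNormalForm]
  · have h1 := contDiff_aeval_unfoldingPolynomial k
    simp only [map_sub, map_mul, map_pow, Polynomial.aeval_C, Polynomial.aeval_X,
      Algebra.algebraMap_eq_smul_one]
    fun_prop
  · simp [unfoldingPolynomial_zero, parabolicPoly]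
  · intro a η
    have h := hasDerivAt_quadratic (a ^ (k + 1) - μ • a ^ (2 * k + 1))
      (Polynomial.aeval a (tangentPoly k 0 η)) 0
    refine h.congr_of_eventuallyEq (Eventually.of_forall fun t => ?_)
    simp only [map_sub, map_mul, map_pow, Polynomial.aeval_C, Polynomial.aeval_X,
      aeval_unfoldingPolynomial, sum_smul_param, aeval_tangentPoly_smul, Prod.smul_snd,
      smul_eq_mul]
    simp only [Algebra.smul_def, map_add, map_mul, map_zero]
    ring

/-- The factor `1 - μ x^k` multiplies the first-order terms, hence `d = μ`; the products `y_j
y_{2k+1}` are of second order in `t`. -/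
lemma isUniversalDeformation_kostovX2 {k : ℕ} (hk : 1 ≤ k) (μ : ℂ) :
    IsUniversalDeformation (kostovX2 k μ) (parabolicNormalForm k μ) := by
  refine isUniversalDeformation (d := μ) (P := fun y => unfoldingPolynomial k y *
    (1 - Polynomial.C (μ + y.2) * Polynomial.X ^ k)) hk ?_ ⟨?_, ?_⟩ ?_ ?_ ?_
  · intro x y
    simp [kostovX2, eval_unfoldingPolynomial]
  · have h1 := contDiff_unfoldingPoly k
    have : ContDiff ℂ ω fun p : ℂ × Param k => kostovX2 k μ p.1 p.2 := by
      unfold kostovX2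
      fun_prop
    exact this.contDiffAt.analyticAt
  · refine Eventually.of_forall fun x => ?_
    simp [kostovX2, unfoldingPoly, parabolicNormalForm]
    ring
  · have h1 := contDiff_aeval_unfoldingPolynomial k
    simp only [map_sub, map_mul, map_pow, map_one, Polynomial.aeval_C, Polynomial.aeval_X,
      Algebra.algebraMap_eq_smul_one]
    fun_prop
  · simp [unfoldingPolynomial_zero, parabolicPoly]
    ring
  · intro a η
    have h := hasDerivAt_quadratic (a ^ (k + 1) * (1 - μ • a ^ k))
      (Polynomial.aeval a (tangentPoly k μ η))
      (-(∑ j : Fin k, η.1 j • a ^ (j : ℕ)) * (η.2 • a ^ k))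
    refine h.congr_of_eventuallyEq (Eventually.of_forall fun t => ?_)
    simp only [map_sub, map_mul, map_pow, map_one, Polynomial.aeval_C, Polynomial.aeval_X,
      aeval_unfoldingPolynomial, sum_smul_param, aeval_tangentPoly_smul, Prod.smul_snd,
      smul_eq_mul]
    simp only [Algebra.smul_def, map_add, map_mul, map_pow]
    ring

end VectorFieldFamily

theorem corollary1 (k : ℕ) (hk : 1 ≤ k) (μ : ℂ) :
    VectorFieldFamily.IsUniversalDeformation (VectorFieldFamily.kostovX1 k μ)
        (VectorFieldFamily.parabolicNormalForm k μ) ∧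
      VectorFieldFamily.IsUniversalDeformation (VectorFieldFamily.kostovX2 k μ)
        (VectorFieldFamily.parabolicNormalForm k μ) :=
  ⟨VectorFieldFamily.isUniversalDeformation_kostovX1 hk μ,
    VectorFieldFamily.isUniversalDeformation_kostovX2 hk μ⟩
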